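/- Let $p$ be a prime and let $C$ be an algebraically closed field extension of $\mathbb{Q}_p$ which is complete for a valuation $v$ with values in $\mathbb{R}\cup\{\infty\}$, normalized by $v(p)=1$; let $\mathcal{O}_C$ be its ring of integers. An *integral Hodge–Tate module* is a triple $X=(T,\omega,\alpha)$ where $T$ is a free $\mathbb{Z}_p$-module of finite rank, $\omega$ is a free $\mathcal{O}_C$-module of finite rank and $\alpha:T\to\omega$ is $\mathbb{Z}_p$-linear with $\mathcal{O}_C\cdot\alpha(T)=\omega$. A *torsion Hodge–Tate module* is a triple $(M,\omega,\alpha)$ where $M$ is a finite abelian $p$-group, $\omega$ is a finitely presented torsion $\mathcal{O}_C$-module and $\alpha:M\to\omega$ is additive with $\mathcal{O}_C\cdot\alpha(M)=\omega$; if $M\neq 0$ its slope is $(\log_p|M|-\deg\omega)/\log_p|M|$, where $\deg\omega=v(\mathrm{Fitt}_0\,\omega)$, i.e. $\deg\omega=\sum_i v(a_i)$ if $\omega\simeq\bigoplus_i\mathcal{O}_C/a_i\mathcal{O}_C$. A subgroup $M'\subset M$ defines the subobject $(M',\mathcal{O}_C\cdot\alpha(M'),\alpha|_{M'})$. A nonzero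 torsion Hodge–Tate module is *semi-stable* if the slope of the subobject defined by any nonzero subgroup is at most its own slope. For $X=(T,\omega,\alpha)$ integral and $n\ge 1$ put $X[p^n]=(p^{-n}T/T,\,p^{-n}\omega/\omega,\,\alpha)$. If $X$ is nonzero, its slope is $\mu(X)=(\operatorname{rk}T-\operatorname{rk}\omega)/\operatorname{rk}T$, and $X$ is *semi-stable* if $X[p]$ is. An integral Hodge–Tate module $X$ is *of HN type* if it has a filtration $0=X_0\subsetneq X_1\subsetneq\dots\subsetneq X_r=X$, given by submodules $T_i\subset T$ with $X_i=(T_i,\mathcal{O}_C\cdot\alpha(T_i),\alpha)$, such that the quotients $X_i/X_{i-1}$ are semi-stable integral Hodge–Tate modules and $\mu(X_1/X_0)>\dots>\mu(X_r/X_{r-1})$. Two integral Hodge–Tate modules are *isogenous* if there are morphisms between them in both directions whose two composites are multiplication by the same power of $p$. For a nonzero integral Hodge–Tate module $X=(T,\omega,\alpha)$, let $Y_n\subset X[p^n]$ be the first step of the Harder–Narasimhan filtration, i.e. the largest among the nonzero subobjects of maximal slope, and let $\mathcal{F}_X=\bigcup_{n\ge 1}Y_n\subset T\otimes\mathbb{Q}_p/\mathbb{Z}_p$.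 Writing $\mathcal{F}_X=\Lambda/T$ with $T\subset\Lambda\subset T[\tfrac1p]$ and $D$ for the largest $\mathbb{Q}_p$-subspace contained in $\Lambda$, let $X/\mathcal{F}_X=(T',\omega',\alpha')$, where $T'=\Lambda/D$, $\alpha'$ is induced by $\alpha$, and $\omega'=\mathcal{O}_C\cdot\alpha'(T')\subset\omega[\tfrac1p]/(C\cdot\alpha(D))$. **Theorem.** Let $X$ be an integral Hodge–Tate module over $\mathcal{O}_C$. Then 1. $X$ is isogenous to an integral Hodge–Tate module of HN type; 2. the descent algorithm starting from $X$ terminates: in the sequence $X_0=X$, $X_{i+1}=X_i/\mathcal{F}_{X_i}$ (as long as $X_i\ne 0$), one has $X_N=0$ for some $N$. -/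

import Mathlib

noncomputable section

namespace HodgeTate

universe u v w

/-! ## The base: `𝒪_C` for a complete valued extension `C` of `ℚ_p`, with `v(p) = 1` -/

section Base

variable (C : Type w) [NormedField C] [IsUltrametricDist C]

/-- The ring of integers `𝒪_C = {x ∈ C : ‖x‖ ≤ 1}`, as a valuation subring of `C`. -/
abbrev OC : ValuationSubring C :=
  (NormedField.valuation (K := C)).valuationSubring

theorem mem_OC_iff (x : C) : x ∈ OC C ↔ ‖x‖ ≤ 1 := by
  rw [Valuation.mem_valuationSubring_iff, ← NNReal.coe_le_coe]
  rfl

variable (p : ℕ) [Fact p.Prime] [NormedAlgebra ℚ_[p] C]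

/-- The structure morphism `ℤ_p → 𝒪_C`. -/
def zpToOC : ℤ_[p] →+* OC C :=
  ((algebraMap ℚ_[p] C).comp PadicInt.Coe.ringHom).codRestrict (OC C).toSubring (by
    intro x
    refine (mem_OC_iff C _).2 ?_
    show ‖algebraMap ℚ_[p] C (x : ℚ_[p])‖ ≤ 1
    rw [norm_algebraMap']
    exact x.norm_le_one)

end Base

/-- The `0`-th Fitting ideal of a module `N`: it is generated by the determinants of all square
matrices of relations between generators of `N`. All finite generating families are allowed at
once; each of them gives the same ideal. -/
def fittingIdeal (R : Type w) [CommRing R] (N : Type v) [AddCommGroup N] [Module R N] : Ideal R :=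
  Ideal.span {d : R | ∃ (n : ℕ) (x : Fin n → N) (A : Matrix (Fin n) (Fin n) R),
    Submodule.span R (Set.range x) = ⊤ ∧ (∀ i, ∑ j, A i j • x j = 0) ∧ d = A.det}

section Degree

variable (p : ℕ) (C : Type w) [NormedField C] [IsUltrametricDist C]

/-- The valuation of a generator of a finitely generated nonzero ideal `I` of `𝒪_C`, where
`v(x) = - log_p ‖x‖`, so that `v(p) = 1`: a generator is an element of `I` of largest norm. -/
def idealValuation (I : Ideal (OC C)) : ℝ :=
  -Real.logb p (⨆ x : I, ‖((x : OC C) : C)‖)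

/-- `deg N = v(Fitt_0 N)`, for a finitely presented torsion `𝒪_C`-module `N`. -/
def degree (N : Type v) [AddCommGroup N] [Module (OC C) N] : ℝ :=
  idealValuation p C (fittingIdeal (OC C) N)

end Degree

/-! ## Hodge-Tate modules -/

/-- A triple `(T, ω, α)`: a `ℤ_p`-module `T`, an `𝒪_C`-module `ω` and a `ℤ_p`-linear map
`α : T → ω`. Integral Hodge-Tate modules are the triples that satisfy `IsIntegral`. Torsion
Hodge-Tate modules (where `T` is a finite abelian `p`-group, that is a `ℤ_p`-module with finitely
many elements) are triples too. -/
structure Triple (p : ℕ) [Fact p.Prime] (C : Type w) [NormedField C] [IsUltrametricDist C]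
    [NormedAlgebra ℚ_[p] C] where
  /-- the `ℤ_p`-module -/
  T : Type u
  /-- the `𝒪_C`-module -/
  ω : Type v
  [instT : AddCommGroup T]
  [modT : Module ℤ_[p] T]
  [instω : AddCommGroup ω]
  [modω : Module (OC C) ω]
  /-- the `ℤ_p`-linear map -/
  α : T →ₛₗ[zpToOC C p] ω

namespace Triple

attribute [instance] Triple.instT Triple.modT Triple.instω Triple.modω

variable {p : ℕ} [Fact p.Prime] {C : Type w} [NormedField C] [IsUltrametricDist C]
  [NormedAlgebra ℚ_[p] C]

/-- `𝒪_C · α(N)`, for `N ⊆ T`. -/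
def spanImage (X : Triple.{u, v, w} p C) (N : Submodule ℤ_[p] X.T) : Submodule (OC C) X.ω :=
  Submodule.span (OC C) (X.α '' (N : Set X.T))

/-- `(T, ω, α)` is an integral Hodge-Tate module: `T` and `ω` are free of finite rank, and
`𝒪_C · α(T) = ω`. -/
structure IsIntegral (X : Triple.{u, v, w} p C) : Prop where
  free_T : Module.Free ℤ_[p] X.T
  finite_T : Module.Finite ℤ_[p] X.T
  free_ω : Module.Free (OC C) X.ω
  finite_ω : Module.Finite (OC C) X.ω
  span_eq_top : X.spanImage ⊤ = ⊤

/-- Morphisms of triples. -/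
structure Hom (X Y : Triple.{u, v, w} p C) where
  f : X.T →ₗ[ℤ_[p]] Y.T
  g : X.ω →ₗ[OC C] Y.ω
  comm : ∀ t, g (X.α t) = Y.α (f t)

/-- `X` and `Y` are isogenous, i.e. isomorphic after inverting `p`: there are morphisms
`X → Y` and `Y → X` whose two composites are the multiplication by a power of `p`. -/
def Isogenous (X Y : Triple.{u, v, w} p C) : Prop :=
  ∃ (n : ℕ) (φ : Hom X Y) (ψ : Hom Y X),
    (∀ t, ψ.f (φ.f t) = (p : ℤ_[p]) ^ n • t) ∧ (∀ x, ψ.g (φ.g x) = (p : OC C) ^ n • x) ∧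
    (∀ t, φ.f (ψ.f t) = (p : ℤ_[p]) ^ n • t) ∧ (∀ x, φ.g (ψ.g x) = (p : OC C) ^ n • x)

/-- The subobject `(N, 𝒪_C · α(N), α|_N)` attached to `N ⊆ T`. -/
def sub (X : Triple.{u, v, w} p C) (N : Submodule ℤ_[p] X.T) : Triple.{u, v, w} p C where
  T := N
  ω := X.spanImage N
  α := (X.α.domRestrict N).codRestrict (X.spanImage N)
    (fun t => Submodule.subset_span ⟨t, t.2, rfl⟩)

/-- The triple `(T/N, ω/W, α mod W)`, for `α(N) ⊆ W`. -/
def quot (X : Triple.{u, v, w} p C) (N : Submodule ℤ_[p] X.T) (W : Submodule (OC C) X.ω)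
    (h : N ≤ W.comap X.α) : Triple.{u, v, w} p C where
  T := X.T ⧸ N
  ω := X.ω ⧸ W
  α := N.mapQ W X.α h

/-- For `A ⊆ B ⊆ T`, the quotient `(B/A, 𝒪_C · α(B) / 𝒪_C · α(A), α)` of the subobject attached to
`B` by the subobject attached to `A`. -/
def subquot (X : Triple.{u, v, w} p C) (A B : Submodule ℤ_[p] X.T) : Triple.{u, v, w} p C :=
  (X.sub B).quot (A.submoduleOf B) ((X.sub B).spanImage (A.submoduleOf B))
    (fun t ht => Submodule.subset_span ⟨t, ht, rfl⟩)

/-- `X[p^n] = (p^{-n}T/T, p^{-n}ω/ω, α)`, written as `(T/p^nT, ω/p^nω, α)` through the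
multiplication by `p^n`. -/
def torsion (X : Triple.{u, v, w} p C) (n : ℕ) : Triple.{u, v, w} p C :=
  X.quot (LinearMap.range (LinearMap.lsmul ℤ_[p] X.T ((p : ℤ_[p]) ^ n)))
    (LinearMap.range (LinearMap.lsmul (OC C) X.ω ((p : OC C) ^ n)))
    (by
      rintro _ ⟨t, rfl⟩
      exact ⟨X.α t, by simp [map_smulₛₗ]⟩)

/-! ## Slopes and semi-stability -/

/-- The height `log_p |M|` of a torsion Hodge-Tate module `(M, ω, α)`. -/
def torsionHeight (M : Triple.{u, v, w} p C) : ℝ :=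
  Real.logb p (Nat.card M.T)

/-- The degree `log_p |M| - deg ω` of a torsion Hodge-Tate module `(M, ω, α)`. -/
def torsionDegree (M : Triple.{u, v, w} p C) : ℝ :=
  M.torsionHeight - degree p C M.ω

/-- The slope `deg / ht` of a nonzero torsion Hodge-Tate module. -/
def torsionSlope (M : Triple.{u, v, w} p C) : ℝ :=
  M.torsionDegree / M.torsionHeight

/-- Semi-stability of a torsion Hodge-Tate module `(M, ω, α)`: it is nonzero, and the slope of the
subobject attached to any nonzero `N ⊆ M` is at most its slope. -/
def TorsionSemistable (M : Triple.{u, v, w} p C) : Prop :=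
  Nontrivial M.T ∧
    ∀ N : Submodule ℤ_[p] M.T, N ≠ ⊥ → (M.sub N).torsionSlope ≤ M.torsionSlope

/-- An integral Hodge-Tate module `X` is semi-stable if `X[p]` is. -/
def Semistable (X : Triple.{u, v, w} p C) : Prop :=
  (X.torsion 1).TorsionSemistable

/-- The slope `(rk T - rk ω) / rk T` of a nonzero integral Hodge-Tate module. -/
def slope (X : Triple.{u, v, w} p C) : ℝ :=
  ((Module.finrank ℤ_[p] X.T : ℝ) - Module.finrank (OC C) X.ω) / Module.finrank ℤ_[p] X.T

/-- An integral Hodge-Tate module `X` is of HN type if it has a filtration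
`0 = X_0 ⊊ X_1 ⊊ ... ⊊ X_r = X` whose graded pieces are semi-stable integral Hodge-Tate modules
with strictly decreasing slopes. -/
def IsHNType (X : Triple.{u, v, w} p C) : Prop :=
  ∃ (r : ℕ) (F : Fin (r + 1) → Submodule ℤ_[p] X.T),
    F 0 = ⊥ ∧ F (Fin.last r) = ⊤ ∧ StrictMono F ∧
    (∀ i : Fin r, (X.subquot (F i.castSucc) (F i.succ)).IsIntegral ∧
      (X.subquot (F i.castSucc) (F i.succ)).Semistable) ∧
    StrictAnti (fun i : Fin r => (X.subquot (F i.castSucc) (F i.succ)).slope)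

/-! ## The descent algorithm -/

/-- `N` is the first step of the Harder-Narasimhan filtration of the torsion Hodge-Tate module
`M ≠ 0`: among the nonzero subobjects of maximal slope, it is the largest. -/
def IsFirstStep (M : Triple.{u, v, w} p C) (N : Submodule ℤ_[p] M.T) : Prop :=
  N ≠ ⊥ ∧ ∀ N' : Submodule ℤ_[p] M.T, N' ≠ ⊥ →
    (M.sub N').torsionSlope ≤ (M.sub N).torsionSlope ∧
      ((M.sub N').torsionSlope = (M.sub N).torsionSlope → N' ≤ N)

/-- One step of the descent algorithm: `X' = X / 𝓕_X`, where
`𝓕_X = ⋃_n Y_n ⊆ T ⊗ ℚ_p/ℤ_p` and `Y_n ⊆ X[p^n]` is the first step of the Harder-Narasimhan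
filtration of `X[p^n]`. The projection is the morphism `(f, g) : X → X'`. On the `T`-side it is
surjective after inverting `p`, and the kernel of
`T ⊗ ℚ_p/ℤ_p → T' ⊗ ℚ_p/ℤ_p` is `𝓕_X`: an element `t ⊗ p^{-n}` dies in `T' ⊗ ℚ_p/ℤ_p` iff
`f t ∈ p^n T'`, and lies in `𝓕_X` iff the class of `t` in `T/p^nT` lies in `Y_n`. On the
`ω`-side, `ω[1/p] → ω'[1/p]` is the quotient by the subspace spanned by `α(ker f)`. -/
def IsDescentStep (X X' : Triple.{u, v, w} p C) : Prop :=
  X'.IsIntegral ∧ ∃ φ : Hom X X',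
    (∀ s : X'.T, ∃ (n : ℕ) (t : X.T), φ.f t = (p : ℤ_[p]) ^ n • s) ∧
    (∀ n : ℕ, 1 ≤ n → ∃ Y : Submodule ℤ_[p] (X.torsion n).T, (X.torsion n).IsFirstStep Y ∧
      ∀ t : X.T, (Submodule.Quotient.mk t : (X.torsion n).T) ∈ Y ↔
        ∃ s : X'.T, φ.f t = (p : ℤ_[p]) ^ n • s) ∧
    (∀ x : X.ω, φ.g x = 0 ↔
      ∃ n : ℕ, (p : OC C) ^ n • x ∈ X.spanImage (LinearMap.ker φ.f))

/-- The descent algorithm started at `X` terminates: in the sequence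
`X_0 = X`, `X_{i+1} = X_i / 𝓕_{X_i}` as long as `X_i ≠ 0`, some term `X_N` is zero. (The quotients
`X_i / 𝓕_{X_i}` are unique up to isomorphism.) -/
def DescentTerminates (X : Triple.{u, v, w} p C) : Prop :=
  ∃ (N : ℕ) (Z : ℕ → Triple.{u, v, w} p C), Z 0 = X ∧
    (∀ i < N, Nontrivial (Z i).T ∧ IsDescentStep (Z i) (Z (i + 1))) ∧ Subsingleton (Z N).T

end Triple

end HodgeTate

end

/-!
Fix the maximal slope `μ` of a nonzero subobject of `X[p]`. On the submodules `A ⊆ T` containing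
some `p ^ k T`, the function `ψ(A) = (1 - μ) ht(T/A) - deg(ω/𝒪_C α(A))` is submodular, vanishes at
`T`, is shifted by a constant `κ` under `A ↦ pA`, and is at least `κ` on the submodules containing
`pT`. Hence `ψ ≥ kκ` on those containing `p ^ k T`, and the preimage `Y_k` in `T` of the first step
of the Harder-Narasimhan filtration of `X[p^k]` is the largest one with `ψ = kκ`. These submodules
decrease, and `pt ∈ Y_{k+1}` if and only if `t ∈ Y_k`. So `D = ⋂ Y_k` is saturated and, `T/pT` being
Artinian, `Y_{m+k} = D + p ^ k Y_m` for some `m` and all `k`; the quotient `X/𝓕_X` is then the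
subobject of the quotient of `X` by `D` that is attached to the image of `Y_m`.

If `D ≠ 0`, the rank drops. If `D = 0`, the quotient `X/𝓕_X` is the subobject attached to `Y_m`,
and the maximal slope of its `p`-torsion is strictly smaller than `μ`. This cannot go on for ever:
a finite-dimensional `ℚ_p`-subspace of `C` contains elements of only finitely many norms up to
powers of `p`, so the slopes of the subobjects of all `Z[p]`, for `Z` isogenous to `X` inside `X`,
form a finite set. Therefore the descent terminates.

When `D ≠ 0`, moreover, `D` is semi-stable of slope `μ`, while all nonzero subobjects of the
quotient by `D` have slope less than `μ`. A module of HN type isogenous to `X` is obtained by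
induction along the descent, by putting `D` below a filtration of the quotient by `D`.
-/

noncomputable section

namespace HodgeTate

universe u v w

open scoped Pointwise

/-! ### Full and saturated submodules -/

section Full

variable {R : Type*} [CommRing R] {a : R} {W : Type*} [AddCommGroup W] [Module R W]

/-- A submodule of `W` is `a`-full if it contains `a ^ k • W` for some `k`; for a finitely generated
`W` this says that both have the same localization away from `a`. -/
def IsFull (a : R) (M : Submodule R W) : Prop :=
  ∃ k : ℕ, a ^ k • (⊤ : Submodule R W) ≤ M

theorem smul_top_le_iff {M : Submodule R W} : a • (⊤ : Submodule R W) ≤ M ↔ ∀ x, a • x ∈ M := by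
  refine ⟨fun h x => h (Submodule.smul_mem_pointwise_smul x a ⊤ Submodule.mem_top), fun h => ?_⟩
  rintro _ ⟨x, -, rfl⟩
  exact h x

theorem isFull_iff {M : Submodule R W} : IsFull a M ↔ ∃ k : ℕ, ∀ x, a ^ k • x ∈ M := by
  simp only [IsFull, smul_top_le_iff]

theorem isFull_top : IsFull a (⊤ : Submodule R W) := ⟨0, le_top⟩

theorem isFull_pow_smul_top (k : ℕ) : IsFull a (a ^ k • (⊤ : Submodule R W)) := ⟨k, le_rfl⟩

theorem IsFull.mono {M N : Submodule R W} (hM : IsFull a M) (h : M ≤ N) : IsFull a N :=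
  hM.imp fun _ hk => hk.trans h

theorem pow_smul_antitone (M : Submodule R W) : Antitone fun k : ℕ => a ^ k • M := by
  intro i j hij
  obtain ⟨d, rfl⟩ := Nat.exists_eq_add_of_le' hij
  simp only [pow_add, mul_smul]
  exact Submodule.smul_le_self_of_tower _ _

theorem IsFull.pow_smul {M : Submodule R W} (hM : IsFull a M) (k : ℕ) : IsFull a (a ^ k • M) := by
  obtain ⟨n, hn⟩ := hM
  refine ⟨k + n, ?_⟩
  rw [pow_add, mul_smul]
  exact smul_mono_right _ hn

theorem IsFull.smul {M : Submodule R W} (hM : IsFull a M) : IsFull a (a • M) := by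
  simpa using hM.pow_smul 1

theorem IsFull.inf {M N : Submodule R W} (hM : IsFull a M) (hN : IsFull a N) :
    IsFull a (M ⊓ N) := by
  obtain ⟨j, hj⟩ := hM
  obtain ⟨k, hk⟩ := hN
  exact ⟨max j k, le_inf ((pow_smul_antitone ⊤ (le_max_left j k)).trans hj)
    ((pow_smul_antitone ⊤ (le_max_right j k)).trans hk)⟩

theorem smul_top_eq_range_lsmul (c : R) :
    c • (⊤ : Submodule R W) = LinearMap.range (LinearMap.lsmul R W c) := Submodule.map_top _

theorem smul_comap_lsmul (c : R) (M : Submodule R W) :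
    c • M.comap (LinearMap.lsmul R W c) = M ⊓ c • ⊤ := by
  ext x
  simp only [Submodule.mem_inf, Submodule.mem_smul_pointwise_iff_exists, Submodule.mem_comap,
    LinearMap.lsmul_apply, Submodule.mem_top, true_and]
  exact ⟨fun ⟨y, hy, hyx⟩ => ⟨hyx ▸ hy, y, hyx⟩, fun ⟨hx, y, hyx⟩ => ⟨y, hyx ▸ hx, hyx⟩⟩

theorem pow_smul_top_le_comap_lsmul {M : Submodule R W} {j k : ℕ}
    (h : a ^ (j + k) • (⊤ : Submodule R W) ≤ M) :
    a ^ j • ⊤ ≤ M.comap (LinearMap.lsmul R W (a ^ k)) := by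
  rw [smul_top_le_iff] at h ⊢
  intro x
  simpa [smul_smul, ← pow_add, add_comm k j] using h x

theorem smul_mem_smul_iff [IsDomain R] [Module.IsTorsionFree R W] {c : R} (hc : c ≠ 0)
    {M : Submodule R W} {x : W} : c • x ∈ c • M ↔ x ∈ M := by
  refine ⟨?_, Submodule.smul_mem_pointwise_smul x c M⟩
  rintro ⟨y, hy, hyx⟩
  rwa [← smul_right_injective W hc hyx]

/-- `M` is `a`-saturated in `W` if `W ⧸ M` has no `a`-torsion. -/
def IsSaturated (a : R) (M : Submodule R W) : Prop := ∀ x, a • x ∈ M → x ∈ M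

theorem IsSaturated.mem_of_pow_smul_mem {M : Submodule R W} (hM : IsSaturated a M) {k : ℕ}
    {x : W} (hx : a ^ k • x ∈ M) : x ∈ M := by
  induction k with
  | zero => simpa using hx
  | succ k ih => exact ih (hM _ (by rwa [smul_smul, ← pow_succ']))

theorem mem_smul_top_iff_dvd_repr {ι : Type*} [Finite ι] (b : Module.Basis ι R W) {x : W} :
    x ∈ a • (⊤ : Submodule R W) ↔ ∀ i, a ∣ b.repr x i := by
  have := Fintype.ofFinite ι
  constructor
  · rintro ⟨y, -, rfl⟩ i
    exact ⟨b.repr y i, by simp⟩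
  · intro h
    choose c hc using h
    rw [← b.sum_repr x]
    simp only [hc, mul_smul, ← Finset.smul_sum]
    exact Submodule.smul_mem_pointwise_smul _ a ⊤ Submodule.mem_top

theorem IsFull.finrank_eq [IsDomain R] [Module.IsTorsionFree R W] [Module.Finite R W]
    {M : Submodule R W} [Module.Finite R M] (ha : a ≠ 0) (hM : IsFull a M) :
    Module.finrank R M = Module.finrank R W := by
  refine le_antisymm (Submodule.finrank_le M) ?_
  obtain ⟨k, hk⟩ := isFull_iff.1 hM
  refine LinearMap.finrank_le_finrank_of_injective
    (f := (LinearMap.lsmul R W (a ^ k)).codRestrict M hk) fun x y hxy => ?_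
  exact smul_right_injective W (pow_ne_zero k ha) (congrArg Subtype.val hxy)

end Full

section Determinants

variable {R : Type*} [CommRing R]

theorem det_dvd_det_of_mul_eq {m n : Type*} [Fintype m] [DecidableEq m] [Fintype n] [DecidableEq n]
    {A Q : Matrix n n R} {B : Matrix m m R} {X Y : Matrix m n R} {P : Matrix n m R}
    (hone : P * X + Q * A = 1) (hmul : B * X = Y * A) : A.det ∣ B.det := by
  have hblocks : Matrix.fromBlocks B (-Y) P Q * Matrix.fromBlocks 1 X 0 A =
      Matrix.fromBlocks B 0 P 1 := by
    simp [Matrix.fromBlocks_multiply, hone, hmul]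
  have hdet := congrArg Matrix.det hblocks
  rw [Matrix.det_mul, Matrix.det_fromBlocks_zero₂₁, Matrix.det_fromBlocks_zero₁₂, Matrix.det_one,
    Matrix.det_one, one_mul, mul_one] at hdet
  exact ⟨_, hdet.symm.trans (mul_comm _ _)⟩

variable {W : Type*} [AddCommGroup W] [Module R W] {ι κ : Type*} [Fintype κ]

theorem transpose_toMatrix_sum_smul (e : Module.Basis ι R W) {m : Type*} (M : Matrix m κ R)
    (v : κ → W) : (e.toMatrix fun i => ∑ j, M i j • v j).transpose =
      M * (e.toMatrix v).transpose := by
  ext i l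
  simp [Module.Basis.toMatrix_apply, Matrix.mul_apply, Finsupp.finsetSum_apply]

theorem det_coe_eq_mul [Fintype ι] [DecidableEq ι] (b : Module.Basis ι R W) {M : Submodule R W}
    (m : Module.Basis ι R M) (v : ι → M) :
    b.det (fun i => (v i : W)) = b.det (fun i => (m i : W)) * m.det v := by
  have := congrArg (fun f => f v)
    (AlternatingMap.eq_smul_basis_det m (b.det.compLinearMap M.subtype))
  simpa [AlternatingMap.compLinearMap_apply] using this

theorem IsFull.det_ne_zero [IsDomain R] {a : R} (ha : a ≠ 0) {M : Submodule R W} (hM : IsFull a M)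
    [Fintype ι] [DecidableEq ι] (b : Module.Basis ι R W) (m : Module.Basis ι R M) :
    b.det (fun i => (m i : W)) ≠ 0 := by
  obtain ⟨k, hk⟩ := isFull_iff.1 hM
  have hmul := det_coe_eq_mul b m fun i => ⟨_, hk (b i)⟩
  have hdet : b.det (fun i => a ^ k • b i) ≠ 0 := by
    rw [AlternatingMap.map_smul_univ, b.det_self]
    simp [ha]
  exact left_ne_zero_of_mul (hmul ▸ hdet)

end Determinants

section Fitting

variable {R : Type w} [CommRing R] {N : Type v} [AddCommGroup N] [Module R N]

theorem det_mem_fittingIdeal_of_presentation {P : Type*} [AddCommGroup P] [Module R P] {n : ℕ}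
    (e : Module.Basis (Fin n) R P) {π : P →ₗ[R] N} (hπ : Function.Surjective π) {u : Fin n → P}
    (hu : ∀ i, π (u i) = 0) : e.det u ∈ fittingIdeal R N := by
  refine Ideal.subset_span ⟨n, fun i => π (e i), (e.toMatrix u).transpose, ?_, fun i => ?_, ?_⟩
  · rw [Set.range_comp' π e, Submodule.span_image, e.span_eq, Submodule.map_top,
      LinearMap.range_eq_top.2 hπ]
  · rw [← hu i, ← congrArg π (e.sum_repr (u i)), map_sum]
    simp only [map_smul, Matrix.transpose_apply, Module.Basis.toMatrix_apply]
  · rw [Matrix.det_transpose, Module.Basis.det_apply]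

theorem det_dvd_det_of_presentation {P : Type*} [AddCommGroup P] [Module R P] {n k : ℕ}
    (e : Module.Basis (Fin n) R P) {π : P →ₗ[R] N} (hπ : Function.Surjective π) {u : Fin n → P}
    (hu : LinearMap.ker π = Submodule.span R (Set.range u)) {x : Fin k → N}
    {B : Matrix (Fin k) (Fin k) R} (hx : Submodule.span R (Set.range x) = ⊤)
    (hB : ∀ i, ∑ j, B i j • x j = 0) : e.det u ∣ B.det := by
  have exists_coeff_ker (y : P) (hy : π y = 0) : ∃ q : Fin n → R, ∑ j, q j • u j = y :=
    Submodule.mem_span_range_iff_exists_fun R |>.1 (hu ▸ LinearMap.mem_ker.2 hy)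
  have exists_coeff (y : N) : ∃ q : Fin k → R, ∑ j, q j • x j = y :=
    Submodule.mem_span_range_iff_exists_fun R |>.1 (hx ▸ Submodule.mem_top)
  choose X hX using fun j => hπ (x j)
  choose P hP using fun i => exists_coeff (π (e i))
  choose Q hQ using fun i => exists_coeff_ker (e i - ∑ j, P i j • X j) (by simp [hX, hP])
  choose Y hY using fun i => exists_coeff_ker (∑ j, B i j • X j) (by simp [hX, hB])
  have hone : Matrix.of P * (e.toMatrix X).transpose +
      Matrix.of Q * (e.toMatrix u).transpose = 1 := by
    rw [← transpose_toMatrix_sum_smul, ← transpose_toMatrix_sum_smul]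
    ext i l
    simp [hQ, Module.Basis.toMatrix_apply, Matrix.one_apply, Finsupp.single_apply]
  have hmul : B * (e.toMatrix X).transpose = Matrix.of Y * (e.toMatrix u).transpose := by
    rw [← transpose_toMatrix_sum_smul, ← transpose_toMatrix_sum_smul]
    simp [hY]
  rw [Module.Basis.det_apply, ← Matrix.det_transpose]
  exact det_dvd_det_of_mul_eq hone hmul

theorem fittingIdeal_eq_of_presentation {P : Type*} [AddCommGroup P] [Module R P] {n : ℕ}
    (e : Module.Basis (Fin n) R P) {π : P →ₗ[R] N} (hπ : Function.Surjective π) {u : Fin n → P}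
    (hu : LinearMap.ker π = Submodule.span R (Set.range u)) :
    fittingIdeal R N = Ideal.span {e.det u} := by
  refine le_antisymm (Ideal.span_le.2 ?_) (Ideal.span_singleton_le_iff_mem _ |>.2 ?_)
  · rintro _ ⟨k, x, B, hx, hB, rfl⟩
    exact Ideal.mem_span_singleton.2 (det_dvd_det_of_presentation e hπ hu hx hB)
  · refine det_mem_fittingIdeal_of_presentation e hπ fun i => ?_
    rw [← LinearMap.mem_ker, hu]
    exact Submodule.subset_span ⟨i, rfl⟩

theorem fittingIdeal_quotient_of_basis {P : Type*} [AddCommGroup P] [Module R P]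
    {Q : Submodule R P} {n : ℕ} (e : Module.Basis (Fin n) R P) (q : Module.Basis (Fin n) R Q) :
    fittingIdeal R (P ⧸ Q) = Ideal.span {e.det fun i => (q i : P)} := by
  refine fittingIdeal_eq_of_presentation e (Submodule.mkQ_surjective Q) ?_
  have hrange : Set.range (fun i => (q i : P)) = Q.subtype '' Set.range q := Set.range_comp _ _
  rw [Submodule.ker_mkQ, hrange, Submodule.span_image, q.span_eq, Submodule.map_top,
    Submodule.range_subtype]

theorem fittingIdeal_le_of_surjective {N' : Type*} [AddCommGroup N'] [Module R N']
    {f : N →ₗ[R] N'} (hf : Function.Surjective f) : fittingIdeal R N ≤ fittingIdeal R N' := by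
  refine Ideal.span_le.2 ?_
  rintro _ ⟨k, x, B, hx, hB, rfl⟩
  refine Ideal.subset_span ⟨k, fun i => f (x i), B, ?_, fun i => ?_, rfl⟩
  · rw [Set.range_comp' f x, Submodule.span_image, hx, Submodule.map_top,
      LinearMap.range_eq_top.2 hf]
  · simpa using congrArg f (hB i)

end Fitting

section Degree

variable {p : ℕ} {C : Type w} [NormedField C] [IsUltrametricDist C]

theorem norm_OC_le_one (x : OC C) : ‖(x : C)‖ ≤ 1 := (mem_OC_iff C _).1 x.2

theorem bddAbove_norm_ideal (I : Ideal (OC C)) :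
    BddAbove (Set.range fun x : I => ‖((x : OC C) : C)‖) :=
  ⟨1, by rintro _ ⟨x, rfl⟩; exact norm_OC_le_one _⟩

theorem idealValuation_span_singleton (d : OC C) :
    idealValuation p C (Ideal.span {d}) = -Real.logb p ‖(d : C)‖ := by
  have hsup : (⨆ x : Ideal.span {d}, ‖((x : OC C) : C)‖) = ‖(d : C)‖ := by
    refine le_antisymm (ciSup_le ?_)
      (le_ciSup (bddAbove_norm_ideal (Ideal.span {d})) ⟨d, Ideal.mem_span_singleton_self d⟩)
    rintro ⟨x, hx⟩
    obtain ⟨y, rfl⟩ := Ideal.mem_span_singleton.1 hx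
    simpa using mul_le_mul_of_nonneg_left (norm_OC_le_one y) (norm_nonneg (d : C))
  rw [idealValuation, hsup]

variable {N : Type v} [AddCommGroup N] [Module (OC C) N] {N' : Type*} [AddCommGroup N']
  [Module (OC C) N']

theorem degree_congr (e : N ≃ₗ[OC C] N') : degree p C N = degree p C N' := by
  rw [degree, degree, le_antisymm (fittingIdeal_le_of_surjective (f := e.toLinearMap) e.surjective)
    (fittingIdeal_le_of_surjective (f := e.symm.toLinearMap) e.symm.surjective)]

theorem degree_quotient_of_basis {P : Type*} [AddCommGroup P] [Module (OC C) P]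
    {Q : Submodule (OC C) P} {n : ℕ} (e : Module.Basis (Fin n) (OC C) P)
    (q : Module.Basis (Fin n) (OC C) Q) :
    degree p C (P ⧸ Q) = -Real.logb p ‖((e.det fun i => (q i : P) : OC C) : C)‖ := by
  rw [degree, fittingIdeal_quotient_of_basis e q, idealValuation_span_singleton]

variable [hp : Fact p.Prime]

theorem one_lt_prime_cast (p : ℕ) [hp : Fact p.Prime] : (1 : ℝ) < p := by
  exact_mod_cast hp.out.one_lt

variable (N) in
theorem degree_nonneg : 0 ≤ degree p C N := by
  rw [degree, idealValuation, neg_nonneg]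
  exact Real.logb_nonpos (one_lt_prime_cast p) (Real.iSup_nonneg fun _ => norm_nonneg _)
    (ciSup_le fun x => norm_OC_le_one _)

theorem degree_le_of_surjective {f : N →ₗ[OC C] N'} (hf : Function.Surjective f)
    (h0 : fittingIdeal (OC C) N ≠ ⊥) : degree p C N' ≤ degree p C N := by
  obtain ⟨d, hd, hd0⟩ := Submodule.exists_mem_ne_zero_of_ne_bot h0
  have hle := fittingIdeal_le_of_surjective hf
  rw [degree, degree, idealValuation, idealValuation, neg_le_neg_iff]
  refine Real.logb_le_logb_of_le (one_lt_prime_cast p) ?_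
    (ciSup_le fun x => le_ciSup (bddAbove_norm_ideal _) ⟨x.1, hle x.2⟩)
  exact lt_of_lt_of_le (by simpa using hd0) (le_ciSup (bddAbove_norm_ideal _) ⟨d, hd⟩)

variable [NormedAlgebra ℚ_[p] C]

theorem norm_natCast_prime : ‖((p : OC C) : C)‖ = (p : ℝ)⁻¹ := by
  have : ((p : OC C) : C) = algebraMap ℚ_[p] C (p : ℚ_[p]) := by simp
  rw [this, norm_algebraMap', Padic.norm_p]

theorem prime_cast_ne_zero : (p : OC C) ≠ 0 := by
  intro h
  have hnorm := norm_natCast_prime (p := p) (C := C)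
  rw [h, ZeroMemClass.coe_zero, norm_zero] at hnorm
  exact inv_ne_zero (Nat.cast_ne_zero.2 hp.out.ne_zero) hnorm.symm

theorem logb_norm_prime_pow (k : ℕ) :
    Real.logb p ‖(((p : OC C) ^ k : OC C) : C)‖ = -(k : ℝ) := by
  rw [SubmonoidClass.coe_pow, norm_pow, norm_natCast_prime, Real.logb_pow, Real.logb_inv,
    Real.logb_self_eq_one (one_lt_prime_cast p)]
  ring

end Degree

/-! ### Lattices and their degree -/

section Lattice

variable {R : Type*} [CommRing R] {a : R} {W : Type*} [AddCommGroup W] [Module R W]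

/-- An `a`-lattice in `W`: a finitely generated `a`-full submodule. -/
structure IsLattice (a : R) (M : Submodule R W) : Prop where
  fg : M.FG
  isFull : IsFull a M

theorem isLattice_top [Module.Finite R W] : IsLattice a (⊤ : Submodule R W) :=
  ⟨Module.Finite.fg_top, isFull_top⟩

theorem IsLattice.mono {Q M : Submodule R W} (hQ : IsLattice a Q) (hM : M.FG) (h : Q ≤ M) :
    IsLattice a M :=
  ⟨hM, hQ.isFull.mono h⟩

theorem free_of_finite_isTorsionFree [IsDomain R] [ValuationRing R] [Module.Finite R W]
    [Module.IsTorsionFree R W] : Module.Free R W := by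
  have : Module.Flat R W := by
    rw [Module.Flat.flat_iff_torsion_eq_bot_of_isBezout,
      ← Submodule.isTorsionFree_iff_torsion_eq_bot]
    infer_instance
  exact Module.free_of_flat_of_isLocalRing

theorem IsLattice.exists_basis [IsDomain R] [ValuationRing R] [Module.IsTorsionFree R W]
    [Module.Finite R W] (ha : a ≠ 0) {M : Submodule R W} (hM : IsLattice a M) :
    Nonempty (Module.Basis (Fin (Module.finrank R W)) R M) := by
  have := Module.Finite.iff_fg.2 hM.fg
  have := free_of_finite_isTorsionFree (R := R) (W := M)
  exact ⟨Module.finBasisOfFinrankEq _ _ (hM.isFull.finrank_eq ha)⟩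

end Lattice

section Codegree

variable {p : ℕ} {C : Type w} [NormedField C] [IsUltrametricDist C]
  {W : Type v} [AddCommGroup W] [Module (OC C) W]

theorem norm_coe_pos {x : OC C} (hx : x ≠ 0) : 0 < ‖(x : C)‖ := by
  simpa using hx

variable (p) in
/-- The degree of `W ⧸ M`. -/
def codegree (M : Submodule (OC C) W) : ℝ := degree p C (W ⧸ M)

theorem codegree_of_basis {r : ℕ} {M : Submodule (OC C) W} (b : Module.Basis (Fin r) (OC C) W)
    (m : Module.Basis (Fin r) (OC C) M) :
    codegree p M = -Real.logb p ‖((b.det fun i => (m i : W) : OC C) : C)‖ :=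
  degree_quotient_of_basis b m

variable [Module.Free (OC C) W] [Module.Finite (OC C) W]

theorem codegree_top : codegree p (⊤ : Submodule (OC C) W) = 0 := by
  let b := Module.finBasis (OC C) W
  have hdet : b.det (fun i => ((b.map Submodule.topEquiv.symm) i : W)) = 1 := b.det_self
  rw [codegree_of_basis b (b.map Submodule.topEquiv.symm), hdet]
  simp

variable [hp : Fact p.Prime] [NormedAlgebra ℚ_[p] C]

theorem exists_basis_submoduleOf {Q M : Submodule (OC C) W} (hQ : IsLattice (p : OC C) Q)
    (h : Q ≤ M) :
    ∃ q : Module.Basis (Fin (Module.finrank (OC C) W)) (OC C) (Q.submoduleOf M),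
      IsFull (p : OC C) (Q.submoduleOf M) ∧
        codegree p Q = -Real.logb p
          ‖(((Module.finBasis (OC C) W).det fun i => ((q i : M) : W) : OC C) : C)‖ := by
  obtain ⟨q⟩ := hQ.exists_basis prime_cast_ne_zero
  refine ⟨q.map (Submodule.submoduleOfEquivOfLe h).symm, isFull_iff.2 ?_, ?_⟩
  · exact (isFull_iff.1 hQ.isFull).imp fun k hk x => hk x
  · exact codegree_of_basis (Module.finBasis (OC C) W) q

theorem codegree_eq_add {Q M : Submodule (OC C) W} (hQ : IsLattice (p : OC C) Q) (hM : M.FG)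
    (h : Q ≤ M) : codegree p Q = codegree p M + degree p C (M ⧸ Q.submoduleOf M) := by
  obtain ⟨m⟩ := (hQ.mono hM h).exists_basis prime_cast_ne_zero
  obtain ⟨q, hfull, hq⟩ := exists_basis_submoduleOf hQ h
  have hm0 := (hQ.isFull.mono h).det_ne_zero prime_cast_ne_zero (Module.finBasis (OC C) W) m
  have hq0 := hfull.det_ne_zero prime_cast_ne_zero m q
  rw [hq, codegree_of_basis (Module.finBasis (OC C) W) m, degree_quotient_of_basis m q,
    det_coe_eq_mul _ m, MulMemClass.coe_mul, norm_mul,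
    Real.logb_mul (norm_coe_pos hm0).ne' (norm_coe_pos hq0).ne']
  ring

theorem fittingIdeal_quotient_ne_bot {Q M : Submodule (OC C) W} (hQ : IsLattice (p : OC C) Q)
    (hM : M.FG) (h : Q ≤ M) : fittingIdeal (OC C) (M ⧸ Q.submoduleOf M) ≠ ⊥ := by
  obtain ⟨m⟩ := (hQ.mono hM h).exists_basis prime_cast_ne_zero
  obtain ⟨q, hfull, -⟩ := exists_basis_submoduleOf hQ h
  rw [fittingIdeal_quotient_of_basis m q]
  simpa using hfull.det_ne_zero prime_cast_ne_zero m q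

theorem degree_sup_quotient_le {Q M M' : Submodule (OC C) W} (hQ : IsLattice (p : OC C) Q)
    (hM' : M'.FG) (h : Q ≤ M) (h' : Q ≤ M') :
    degree p C (↥(M ⊔ M') ⧸ M.submoduleOf (M ⊔ M')) ≤ degree p C (M' ⧸ Q.submoduleOf M') := by
  have hcomap : Q.submoduleOf M' ≤ (M.submoduleOf (M ⊔ M')).comap
      (Submodule.inclusion (le_sup_right : M' ≤ M ⊔ M')) := fun x hx => h hx
  refine degree_le_of_surjective (f := Submodule.mapQ _ _ _ hcomap) (fun y => ?_)
    (fittingIdeal_quotient_ne_bot hQ hM' h')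
  obtain ⟨⟨y, hy⟩, rfl⟩ := Submodule.mkQ_surjective _ y
  obtain ⟨a, ha, c, hc, rfl⟩ := Submodule.mem_sup.1 hy
  refine ⟨Submodule.Quotient.mk ⟨c, hc⟩, (Submodule.Quotient.eq _).2 ?_⟩
  change c - (a + c) ∈ M
  simpa using ha

theorem codegree_add_le {Q M M' : Submodule (OC C) W} (hQ : IsLattice (p : OC C) Q)
    (hM : M.FG) (hM' : M'.FG) (h : Q ≤ M) (h' : Q ≤ M') :
    codegree p M + codegree p M' ≤ codegree p (M ⊔ M') + codegree p Q := by
  rw [codegree_eq_add (hQ.mono hM h) (hM.sup hM') le_sup_left, codegree_eq_add hQ hM' h']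
  linarith [degree_sup_quotient_le hQ hM' h h']

theorem codegree_le {Q M : Submodule (OC C) W} (hQ : IsLattice (p : OC C) Q) (hM : M.FG)
    (h : Q ≤ M) : codegree p M ≤ codegree p Q :=
  codegree_eq_add hQ hM h ▸ le_add_of_nonneg_right (degree_nonneg _)

theorem codegree_prime_pow_smul {M : Submodule (OC C) W} (hM : IsLattice (p : OC C) M) (k : ℕ) :
    codegree p ((p : OC C) ^ k • M) = codegree p M + k * Module.finrank (OC C) W := by
  obtain ⟨m⟩ := hM.exists_basis prime_cast_ne_zero
  let b := Module.finBasis (OC C) W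
  have hp0 : (p : OC C) ^ k ≠ 0 := pow_ne_zero k prime_cast_ne_zero
  have hinj : Function.Injective (DistribSMul.toLinearMap (OC C) W ((p : OC C) ^ k)) :=
    smul_right_injective W hp0
  let q : Module.Basis _ (OC C) ↥((p : OC C) ^ k • M) :=
    m.map (Submodule.equivMapOfInjective _ hinj M)
  have hq : (fun i => (q i : W)) = fun i => (p : OC C) ^ k • (m i : W) := rfl
  have hm0 := hM.isFull.det_ne_zero prime_cast_ne_zero b m
  rw [codegree_of_basis b q, codegree_of_basis b m, hq, AlternatingMap.map_smul_univ]
  simp only [Finset.prod_const, Finset.card_univ, Fintype.card_fin, smul_eq_mul]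
  rw [MulMemClass.coe_mul, norm_mul,
    Real.logb_mul (norm_coe_pos (pow_ne_zero _ hp0)).ne' (norm_coe_pos hm0).ne', ← pow_mul,
    logb_norm_prime_pow]
  push_cast
  ring

end Codegree

/-! ### Minimizing slope functions -/

section Coheight

variable {p : ℕ} [hp : Fact p.Prime] {T : Type u} [AddCommGroup T] [Module ℤ_[p] T]

variable (p) in
/-- The height `log_p |T/A|` of `T ⧸ A`. -/
def coheight (A : Submodule ℤ_[p] T) : ℝ := Real.logb p A.toAddSubgroup.index

theorem prime_pow_ne_zero (k : ℕ) : (p : ℤ_[p]) ^ k ≠ 0 :=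
  pow_ne_zero _ (Nat.cast_ne_zero.2 hp.out.ne_zero)

theorem coheight_top : coheight p (⊤ : Submodule ℤ_[p] T) = 0 := by simp [coheight]

theorem coheight_eq_of_index_eq_pow {A : Submodule ℤ_[p] T} {j : ℕ}
    (h : A.toAddSubgroup.index = p ^ j) : coheight p A = j := by
  rw [coheight, h, Nat.cast_pow, Real.logb_pow, Real.logb_self_eq_one (one_lt_prime_cast p),
    mul_one]

variable [Module.Free ℤ_[p] T] [Module.Finite ℤ_[p] T]

theorem index_prime_smul_top :
    ((p : ℤ_[p]) • (⊤ : Submodule ℤ_[p] T)).toAddSubgroup.index = p ^ Module.finrank ℤ_[p] T := by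
  let b := Module.finBasis ℤ_[p] T
  let reduction : T →+ (Fin (Module.finrank ℤ_[p] T) → ZMod p) :=
    (PadicInt.toZMod.compLeft _).toAddMonoidHom.comp b.equivFun.toAddEquiv.toAddMonoidHom
  have hsurj : Function.Surjective reduction :=
    (ZMod.ringHom_surjective (PadicInt.toZMod (p := p))).comp_left.comp b.equivFun.surjective
  have hker : reduction.ker = ((p : ℤ_[p]) • (⊤ : Submodule ℤ_[p] T)).toAddSubgroup := by
    ext t
    rw [Submodule.mem_toAddSubgroup, mem_smul_top_iff_dvd_repr b, AddMonoidHom.mem_ker, funext_iff]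
    refine forall_congr' fun i => ?_
    rw [← Ideal.mem_span_singleton, ← PadicInt.maximalIdeal_eq_span_p, ← PadicInt.ker_toZMod]
    rfl
  rw [← hker, AddSubgroup.index_ker, AddMonoidHom.range_eq_top.2 hsurj]
  simp

theorem index_prime_smul (A : Submodule ℤ_[p] T) :
    ((p : ℤ_[p]) • A).toAddSubgroup.index =
      A.toAddSubgroup.index * p ^ Module.finrank ℤ_[p] T := by
  have hinj : Function.Injective (DistribSMul.toLinearMap ℤ_[p] T (p : ℤ_[p])) :=
    smul_right_injective T (Nat.cast_ne_zero.2 hp.out.ne_zero)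
  have hindex := AddSubgroup.index_map_of_injective A.toAddSubgroup
    (f := (DistribSMul.toLinearMap ℤ_[p] T (p : ℤ_[p])).toAddMonoidHom) hinj
  have htop : (p : ℤ_[p]) • (⊤ : Submodule ℤ_[p] T) =
      LinearMap.range (DistribSMul.toLinearMap ℤ_[p] T (p : ℤ_[p])) := Submodule.map_top _
  rw [← index_prime_smul_top, htop]
  exact hindex

theorem index_prime_pow_smul (k : ℕ) (A : Submodule ℤ_[p] T) :
    ((p : ℤ_[p]) ^ k • A).toAddSubgroup.index =
      A.toAddSubgroup.index * p ^ (k * Module.finrank ℤ_[p] T) := by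
  induction k with
  | zero => simp
  | succ k ih =>
    rw [pow_succ', mul_smul, index_prime_smul, ih, mul_assoc, ← pow_add, Nat.succ_mul]

theorem IsFull.exists_index_eq_pow {A : Submodule ℤ_[p] T} (hA : IsFull (p : ℤ_[p]) A) :
    ∃ j : ℕ, A.toAddSubgroup.index = p ^ j := by
  obtain ⟨k, hk⟩ := hA
  have hdvd := AddSubgroup.index_dvd_of_le (Submodule.toAddSubgroup_mono hk)
  rw [index_prime_pow_smul, Submodule.top_toAddSubgroup, AddSubgroup.index_top, one_mul] at hdvd
  exact ((Nat.dvd_prime_pow hp.out).1 hdvd).imp fun _ h => h.2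

theorem IsFull.index_ne_zero {A : Submodule ℤ_[p] T} (hA : IsFull (p : ℤ_[p]) A) :
    A.toAddSubgroup.index ≠ 0 := by
  obtain ⟨j, hj⟩ := hA.exists_index_eq_pow
  exact hj ▸ pow_ne_zero _ hp.out.ne_zero

theorem IsFull.exists_coheight_eq_natCast {A : Submodule ℤ_[p] T} (hA : IsFull (p : ℤ_[p]) A) :
    ∃ j : ℕ, coheight p A = j :=
  hA.exists_index_eq_pow.imp fun _ => coheight_eq_of_index_eq_pow

theorem coheight_prime_pow_smul {A : Submodule ℤ_[p] T} (hA : IsFull (p : ℤ_[p]) A) (k : ℕ) :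
    coheight p ((p : ℤ_[p]) ^ k • A) = coheight p A + k * Module.finrank ℤ_[p] T := by
  obtain ⟨j, hj⟩ := hA.exists_index_eq_pow
  have hj' := index_prime_pow_smul k A
  rw [hj, ← pow_add] at hj'
  rw [coheight_eq_of_index_eq_pow hj, coheight_eq_of_index_eq_pow hj']
  push_cast
  rfl

theorem coheight_prime_smul {A : Submodule ℤ_[p] T} (hA : IsFull (p : ℤ_[p]) A) :
    coheight p ((p : ℤ_[p]) • A) = coheight p A + Module.finrank ℤ_[p] T := by
  simpa using coheight_prime_pow_smul hA 1

variable (p T) in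
theorem finite_quotient_prime_smul_top : Finite (T ⧸ (p : ℤ_[p]) • (⊤ : Submodule ℤ_[p] T)) :=
  Nat.finite_of_card_ne_zero ((index_prime_smul_top (p := p) (T := T)).trans_ne
    (pow_ne_zero _ hp.out.ne_zero))

theorem coheight_eq_add {A B : Submodule ℤ_[p] T} (hA : IsFull (p : ℤ_[p]) A) (h : A ≤ B) :
    coheight p A = coheight p B + Real.logb p (Nat.card (B ⧸ A.submoduleOf B)) := by
  have hindex := AddSubgroup.relIndex_mul_index (Submodule.toAddSubgroup_mono h)
  have hcard : A.toAddSubgroup.relIndex B.toAddSubgroup = Nat.card (B ⧸ A.submoduleOf B) := rfl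
  have hne := hindex ▸ hA.index_ne_zero
  rw [coheight, coheight, ← hcard, ← hindex, Nat.cast_mul, add_comm, Real.logb_mul
    (Nat.cast_ne_zero.2 (left_ne_zero_of_mul hne)) (Nat.cast_ne_zero.2 (right_ne_zero_of_mul hne))]

theorem coheight_sup_add_inf {A B : Submodule ℤ_[p] T} (hA : IsFull (p : ℤ_[p]) A)
    (hB : IsFull (p : ℤ_[p]) B) :
    coheight p (A ⊔ B) + coheight p (A ⊓ B) = coheight p A + coheight p B := by
  have hcard : Nat.card (B ⧸ (B ⊓ A).submoduleOf B) =
      Nat.card (↥(B ⊔ A) ⧸ A.submoduleOf (B ⊔ A)) :=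
    Nat.card_congr (LinearMap.quotientInfEquivSupQuotient B A).toEquiv
  rw [sup_comm, inf_comm, coheight_eq_add (inf_comm A B ▸ hA.inf hB) (inf_le_left : B ⊓ A ≤ B),
    coheight_eq_add hA (le_sup_right : A ≤ B ⊔ A), hcard]
  ring

theorem coheight_lt {A B : Submodule ℤ_[p] T} (hA : IsFull (p : ℤ_[p]) A) (h : A < B) :
    coheight p B < coheight p A := by
  have hindex := AddSubgroup.relIndex_mul_index (Submodule.toAddSubgroup_mono h.le)
  have hpos := Nat.pos_of_ne_zero (hA.mono h.le).index_ne_zero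
  have hrel : A.toAddSubgroup.relIndex B.toAddSubgroup ≠ 1 := fun h1 =>
    h.not_ge (AddSubgroup.relIndex_eq_one.1 h1)
  have hrel0 := left_ne_zero_of_mul (hindex ▸ hA.index_ne_zero)
  refine Real.logb_lt_logb (one_lt_prime_cast p) (Nat.cast_pos.2 hpos) (Nat.cast_lt.2 ?_)
  rw [← hindex]
  exact lt_mul_of_one_lt_left hpos (by omega)

theorem coheight_le {A B : Submodule ℤ_[p] T} (hA : IsFull (p : ℤ_[p]) A) (h : A ≤ B) :
    coheight p B ≤ coheight p A :=
  h.eq_or_lt.elim (fun h => h ▸ le_rfl) fun h => (coheight_lt hA h).le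

end Coheight

section Filtration

variable {R : Type*} [CommRing R] {a : R} {T : Type*} [AddCommGroup T] [Module R T]

/-- The properties of `ψ(A) = (1 - μ) ht(T/A) - deg(ω/𝒪α(A))`, for `μ` the maximal slope of `X[p]`
and `κ = (1 - μ) rk T - rk ω`, that determine the first steps of the Harder-Narasimhan filtrations
of all `X[p^k]`. -/
structure IsSlopeFunction (a : R) (ψ : Submodule R T → ℝ) (κ : ℝ) : Prop where
  sup_add_inf_le : ∀ A B, IsFull a A → IsFull a B → ψ (A ⊔ B) + ψ (A ⊓ B) ≤ ψ A + ψ B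
  smul : ∀ A, IsFull a A → ψ (a • A) = ψ A + κ
  top : ψ ⊤ = 0
  le_of_smul_top_le : ∀ A, a • ⊤ ≤ A → κ ≤ ψ A

/-- `Y k` is the largest minimizer of `ψ` among the submodules that contain `a ^ k • T`. For the
slope function of `X` it is the preimage in `T` of the first Harder-Narasimhan step of `X[p^k]`. -/
structure IsSlopeFiltration (a : R) (ψ : Submodule R T → ℝ) (κ : ℝ) (Y : ℕ → Submodule R T) :
    Prop where
  pow_smul_top_le : ∀ k : ℕ, a ^ k • ⊤ ≤ Y k
  apply_eq : ∀ k : ℕ, ψ (Y k) = k * κ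
  le_of_apply_le : ∀ (k : ℕ) A, a ^ k • ⊤ ≤ A → ψ A ≤ k * κ → A ≤ Y k

namespace IsSlopeFunction

variable {ψ : Submodule R T → ℝ} {κ : ℝ} (hψ : IsSlopeFunction a ψ κ)
include hψ

theorem pow_smul {A : Submodule R T} (hA : IsFull a A) (k : ℕ) :
    ψ (a ^ k • A) = ψ A + k * κ := by
  induction k with
  | zero => simp
  | succ k ih =>
    rw [pow_succ', mul_smul, hψ.smul _ (hA.pow_smul k), ih]
    push_cast
    ring

theorem pow_smul_top (k : ℕ) : ψ (a ^ k • ⊤) = k * κ := by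
  rw [hψ.pow_smul isFull_top, hψ.top, zero_add]

theorem sup_add_comap_le {A : Submodule R T} {j k : ℕ} (hA : a ^ (j + k) • ⊤ ≤ A) :
    ψ (A ⊔ a ^ k • ⊤) + ψ (A.comap (LinearMap.lsmul R T (a ^ k))) ≤ ψ A := by
  have hsub := hψ.sup_add_inf_le A _ ⟨_, hA⟩ (isFull_pow_smul_top k)
  rw [← smul_comap_lsmul, hψ.pow_smul ⟨j, pow_smul_top_le_comap_lsmul hA⟩,
    hψ.pow_smul_top] at hsub
  linarith

theorem le {k : ℕ} {A : Submodule R T} (hA : a ^ k • ⊤ ≤ A) : k * κ ≤ ψ A := by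
  induction k generalizing A with
  | zero =>
    obtain rfl : A = ⊤ := by simpa using hA
    simp [hψ.top]
  | succ k ih =>
    have hcomap := ih (pow_smul_top_le_comap_lsmul hA)
    have hsup := hψ.le_of_smul_top_le (A ⊔ a ^ 1 • ⊤) (by simp)
    have hadd := hψ.sup_add_comap_le hA
    push_cast
    linarith

theorem exists_isSlopeFiltration [IsNoetherian R T] : ∃ Y, IsSlopeFiltration a ψ κ Y := by
  have exists_max (k : ℕ) : ∃ Y : Submodule R T, a ^ k • ⊤ ≤ Y ∧ ψ Y = k * κ ∧
      ∀ A, a ^ k • ⊤ ≤ A → ψ A ≤ k * κ → A ≤ Y := by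
    let S : Set (Submodule R T) := {A | a ^ k • ⊤ ≤ A ∧ ψ A ≤ k * κ}
    obtain ⟨Y, ⟨hkY, hY⟩, hmax⟩ := set_has_maximal_iff_noetherian.2 ‹IsNoetherian R T› S
      ⟨a ^ k • ⊤, le_rfl, (hψ.pow_smul_top k).le⟩
    refine ⟨Y, hkY, le_antisymm hY (hψ.le hkY), fun A hkA hA => ?_⟩
    have hsub := hψ.sup_add_inf_le Y A ⟨k, hkY⟩ ⟨k, hkA⟩
    have hinf := hψ.le (le_inf hkY hkA)
    have hsup : Y ⊔ A ∈ S := ⟨hkY.trans le_sup_left, by linarith⟩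
    exact sup_eq_left.1 (le_sup_left.eq_of_not_lt (hmax _ hsup)).symm
  choose Y hkY hY hmax using exists_max
  exact ⟨Y, hkY, hY, hmax⟩

end IsSlopeFunction

namespace IsSlopeFiltration

variable {ψ : Submodule R T → ℝ} {κ : ℝ} {Y : ℕ → Submodule R T} (hψ : IsSlopeFunction a ψ κ)
  (hY : IsSlopeFiltration a ψ κ Y)
include hψ hY

theorem succ_le (k : ℕ) : Y (k + 1) ≤ Y k := by
  have hk : a ^ (1 + k) • ⊤ ≤ Y (k + 1) := add_comm k 1 ▸ hY.pow_smul_top_le (k + 1)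
  have hadd := hψ.sup_add_comap_le hk
  have hcomap := hψ.le (pow_smul_top_le_comap_lsmul hk)
  refine le_sup_left.trans (hY.le_of_apply_le k _ le_sup_right ?_)
  rw [hY.apply_eq] at hadd
  push_cast at hadd hcomap
  linarith

theorem smul_mem_succ_iff (k : ℕ) {t : T} : a • t ∈ Y (k + 1) ↔ t ∈ Y k := by
  constructor
  · intro ht
    have hcomap := pow_smul_top_le_comap_lsmul (hY.pow_smul_top_le (k + 1))
    have hadd := hψ.sup_add_comap_le (hY.pow_smul_top_le (k + 1))
    have hsup := hψ.le (le_sup_right : a ^ 1 • ⊤ ≤ Y (k + 1) ⊔ a ^ 1 • ⊤)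
    refine hY.le_of_apply_le k _ hcomap ?_ (by simpa using ht)
    rw [hY.apply_eq] at hadd
    push_cast at hadd hsup
    linarith
  · intro ht
    refine hY.le_of_apply_le (k + 1) (a • Y k) ?_ ?_ (Submodule.smul_mem_pointwise_smul t a _ ht)
    · rw [pow_succ', mul_smul]
      exact smul_mono_right a (hY.pow_smul_top_le k)
    · rw [hψ.smul _ ⟨k, hY.pow_smul_top_le k⟩, hY.apply_eq]
      push_cast
      linarith

end IsSlopeFiltration

end Filtration

section Limit

variable {R : Type*} [CommRing R] {T : Type*} [AddCommGroup T] [Module R T]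

theorem isClosed_submodule_pi [TopologicalSpace R] [IsTopologicalRing R] [CompactSpace R]
    [T2Space R] [IsNoetherianRing R] {ι : Type*} [Finite ι] (N : Submodule R (ι → R)) :
    IsClosed (N : Set (ι → R)) := by
  obtain ⟨m, f, hf⟩ := (Submodule.fg_iff_exists_fin_linearMap _ _).1 (IsNoetherian.noetherian N)
  rw [← hf, LinearMap.coe_range]
  exact (isCompact_range f.continuous_on_pi).isClosed

theorem mem_iInf_sup_of_forall [TopologicalSpace R] [IsTopologicalRing R] [CompactSpace R]
    [T2Space R] [IsNoetherianRing R] [Module.Finite R T] {A : ℕ → Submodule R T}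
    (hA : ∀ k, A (k + 1) ≤ A k) (B : Submodule R T) {t : T} (ht : ∀ k, t ∈ A k ⊔ B) :
    t ∈ (⨅ k, A k) ⊔ B := by
  obtain ⟨n, f, hf⟩ := Module.Finite.exists_fin' R T
  obtain ⟨y, rfl⟩ := hf t
  let K : ℕ → Set (Fin n → R) := fun k =>
    ((A k).comap f : Set (Fin n → R)) ∩ (fun x => y - x) ⁻¹' (B.comap f : Set (Fin n → R))
  have hclosed (k : ℕ) : IsClosed (K k) :=
    (isClosed_submodule_pi _).inter ((isClosed_submodule_pi _).preimage (by fun_prop))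
  have hnonempty (k : ℕ) : (K k).Nonempty := by
    obtain ⟨c, hc, b, hb, hcb⟩ := Submodule.mem_sup.1 (ht k)
    obtain ⟨x, rfl⟩ := hf c
    refine ⟨x, hc, ?_⟩
    simpa [← hcb] using hb
  obtain ⟨x, hx⟩ := IsCompact.nonempty_iInter_of_sequence_nonempty_isCompact_isClosed K
    (fun k x hx => ⟨hA k hx.1, hx.2⟩) hnonempty (hclosed 0).isCompact hclosed
  rw [Set.mem_iInter] at hx
  refine Submodule.mem_sup.2
    ⟨f x, (Submodule.mem_iInf _).2 fun k => (hx k).1, f (y - x), (hx 0).2, by simp⟩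

variable {a : R} {Y : ℕ → Submodule R T}

theorem pow_smul_mem_iff (hsmul : ∀ k t, a • t ∈ Y (k + 1) ↔ t ∈ Y k) (j k : ℕ) (t : T) :
    a ^ j • t ∈ Y (k + j) ↔ t ∈ Y k := by
  induction j with
  | zero => simp
  | succ j ih => rw [pow_succ', mul_smul, ← add_assoc, hsmul, ih]

theorem isSaturated_iInf (hsmul : ∀ k t, a • t ∈ Y (k + 1) ↔ t ∈ Y k) :
    IsSaturated a (⨅ k, Y k) := by
  intro t ht
  rw [Submodule.mem_iInf] at *
  exact fun k => (hsmul k t).1 (ht _)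

theorem exists_forall_le_sup_smul_top [IsArtinian R (T ⧸ a • (⊤ : Submodule R T))]
    (hY : ∀ k, Y (k + 1) ≤ Y k) : ∃ m, ∀ k, Y m ≤ Y k ⊔ a • ⊤ := by
  have hanti : Antitone Y := antitone_nat_of_succ_le hY
  let image : ℕ →o (Submodule R (T ⧸ a • (⊤ : Submodule R T)))ᵒᵈ :=
    ⟨fun k => OrderDual.toDual ((Y k).map (a • (⊤ : Submodule R T)).mkQ),
      fun _ _ hij => Submodule.map_mono (hanti hij)⟩
  obtain ⟨m, hm⟩ := IsArtinian.monotone_stabilizes image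
  refine ⟨m, fun k => ?_⟩
  rcases le_total m k with hk | hk
  · have himage : (Y m).map (a • (⊤ : Submodule R T)).mkQ =
        (Y k).map (a • (⊤ : Submodule R T)).mkQ := hm k hk
    rw [sup_comm, ← Submodule.comap_map_mkQ, ← himage]
    exact Submodule.le_comap_map _ _
  · exact (hanti hk).trans le_sup_left

theorem exists_filtration_le_iInf_sup [TopologicalSpace R] [IsTopologicalRing R] [CompactSpace R]
    [T2Space R] [IsNoetherianRing R] [Module.Finite R T]
    [IsArtinian R (T ⧸ a • (⊤ : Submodule R T))]
    (hY : ∀ k, Y (k + 1) ≤ Y k) (hsmul : ∀ k t, a • t ∈ Y (k + 1) ↔ t ∈ Y k) :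
    ∃ m, ∀ k, Y (m + k) ≤ (⨅ k, Y k) ⊔ a ^ k • Y m := by
  have hanti : Antitone Y := antitone_nat_of_succ_le hY
  obtain ⟨m, hm⟩ := exists_forall_le_sup_smul_top (a := a) hY
  have hsucc (k : ℕ) : Y (m + k + 1) ≤ (⨅ k, Y k) ⊔ a • Y (m + k) := by
    intro t ht
    obtain ⟨d, hd, _, ⟨s, -, rfl⟩, rfl⟩ := Submodule.mem_sup.1
      (mem_iInf_sup_of_forall hY _ fun j => hm j (hanti (by omega) ht))
    have hs : a • s ∈ Y (m + k + 1) := by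
      simpa using (Y (m + k + 1)).sub_mem ht ((Submodule.mem_iInf _).1 hd (m + k + 1))
    exact Submodule.add_mem_sup hd
      (Submodule.smul_mem_pointwise_smul s a _ ((hsmul _ _).1 hs))
  refine ⟨m, fun k => ?_⟩
  induction k with
  | zero => simp
  | succ k ih =>
    refine (hsucc k).trans (sup_le le_sup_left ((smul_mono_right a ih).trans ?_))
    rw [Submodule.smul_sup', ← mul_smul, ← pow_succ']
    exact sup_le_sup_right (Submodule.smul_le_self_of_tower _ _) _

theorem mem_filtration_iff (hsmul : ∀ k t, a • t ∈ Y (k + 1) ↔ t ∈ Y k) {m : ℕ}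
    (hm : ∀ k, Y (m + k) ≤ (⨅ k, Y k) ⊔ a ^ k • Y m) (k : ℕ) {t : T} :
    t ∈ Y k ↔ a ^ m • t ∈ (⨅ k, Y k) ⊔ a ^ k • Y m := by
  rw [← pow_smul_mem_iff hsmul m k, add_comm]
  have hle : a ^ k • Y m ≤ Y (m + k) := by
    rintro _ ⟨y, hy, rfl⟩
    exact (pow_smul_mem_iff hsmul k m y).2 hy
  exact ⟨fun ht => hm k ht, fun ht => sup_le (iInf_le _ _) hle ht⟩

end Limit

/-! ### The slope function of an integral Hodge-Tate module -/

/-- The image of `M` in `W ⧸ Q` as a quotient of `M`. -/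
def mapMkQEquiv {R : Type*} [CommRing R] {W : Type*} [AddCommGroup W] [Module R W]
    (Q M : Submodule R W) : (M ⧸ Q.submoduleOf M) ≃ₗ[R] M.map Q.mkQ :=
  (Submodule.quotEquivOfEq _ _ (by
    ext x
    rw [LinearMap.mem_ker, Subtype.ext_iff]
    exact (Submodule.Quotient.mk_eq_zero Q).symm)).trans
    ((Q.mkQ.submoduleMap M).quotKerEquivOfSurjective (Q.mkQ.submoduleMap_surjective M))

namespace Triple

variable {p : ℕ} [hp : Fact p.Prime] {C : Type w} [NormedField C] [IsUltrametricDist C]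
  [NormedAlgebra ℚ_[p] C]

section SpanImage

variable (X Z : Triple.{u, v, w} p C)

theorem α_smul (c : ℤ_[p]) (t : X.T) : X.α (c • t) = zpToOC C p c • X.α t := map_smulₛₗ _ _ _

theorem α_prime_pow_smul (k : ℕ) (t : X.T) :
    X.α ((p : ℤ_[p]) ^ k • t) = (p : OC C) ^ k • X.α t := by
  rw [α_smul, map_pow, map_natCast]

theorem mem_spanImage {A : Submodule ℤ_[p] X.T} {t : X.T} (ht : t ∈ A) :
    X.α t ∈ X.spanImage A := Submodule.subset_span ⟨t, ht, rfl⟩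

theorem spanImage_mono {A B : Submodule ℤ_[p] X.T} (h : A ≤ B) : X.spanImage A ≤ X.spanImage B :=
  Submodule.span_mono (Set.image_mono h)

theorem spanImage_le {A : Submodule ℤ_[p] X.T} {M : Submodule (OC C) X.ω}
    (h : ∀ t ∈ A, X.α t ∈ M) : X.spanImage A ≤ M := by
  rw [spanImage, Submodule.span_le]
  rintro _ ⟨t, ht, rfl⟩
  exact h t ht

theorem spanImage_bot : X.spanImage ⊥ = ⊥ := by simp [spanImage]

theorem spanImage_sup (A B : Submodule ℤ_[p] X.T) :
    X.spanImage (A ⊔ B) = X.spanImage A ⊔ X.spanImage B := by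
  refine le_antisymm (X.spanImage_le fun t ht => ?_)
    (sup_le (X.spanImage_mono le_sup_left) (X.spanImage_mono le_sup_right))
  obtain ⟨a, ha, b, hb, rfl⟩ := Submodule.mem_sup.1 ht
  rw [map_add]
  exact Submodule.add_mem_sup (X.mem_spanImage ha) (X.mem_spanImage hb)

theorem spanImage_prime_pow_smul (k : ℕ) (A : Submodule ℤ_[p] X.T) :
    X.spanImage ((p : ℤ_[p]) ^ k • A) = (p : OC C) ^ k • X.spanImage A := by
  rw [spanImage, spanImage, Submodule.smul_span, Submodule.coe_pointwise_smul,
    ← Set.image_smul, ← Set.image_smul, ← Set.image_comp, ← Set.image_comp]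
  congr 2
  ext t
  exact X.α_prime_pow_smul k t

theorem spanImage_fg [Module.Finite ℤ_[p] X.T] (A : Submodule ℤ_[p] X.T) :
    (X.spanImage A).FG := by
  obtain ⟨s, hs⟩ := IsNoetherian.noetherian A
  classical
  refine ⟨s.image X.α, le_antisymm ?_ ?_⟩
  · rw [Submodule.span_le, Finset.coe_image]
    rintro _ ⟨t, ht, rfl⟩
    exact X.mem_spanImage (hs ▸ Submodule.subset_span ht)
  · refine X.spanImage_le fun t ht => ?_
    rw [← hs] at ht
    induction ht using Submodule.span_induction with
    | mem t ht => exact Submodule.subset_span (by simpa using ⟨t, ht, rfl⟩)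
    | zero => simp
    | add a b _ _ ha hb => rw [map_add]; exact Submodule.add_mem _ ha hb
    | smul c a _ ha => rw [α_smul]; exact Submodule.smul_mem _ _ ha

variable {X Z} in
theorem Hom.map_spanImage (φ : Hom X Z) (A : Submodule ℤ_[p] X.T) :
    (X.spanImage A).map φ.g = Z.spanImage (A.map φ.f) := by
  rw [spanImage, spanImage, Submodule.map_span, ← Set.image_comp, Submodule.map_coe,
    ← Set.image_comp]
  congr 2
  ext t
  exact φ.comm t

variable {X Z} in
theorem Hom.spanImage_top_of_surjective (φ : Hom X Z) (hf : Function.Surjective φ.f)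
    (hg : Function.Surjective φ.g) (hX : X.spanImage ⊤ = ⊤) : Z.spanImage ⊤ = ⊤ := by
  have hmap := φ.map_spanImage ⊤
  rw [hX, Submodule.map_top, Submodule.map_top, LinearMap.range_eq_top.2 hf,
    LinearMap.range_eq_top.2 hg] at hmap
  exact hmap.symm

/-- The inclusion of a subobject. -/
def subHom (A : Submodule ℤ_[p] X.T) : Hom (X.sub A) X :=
  ⟨A.subtype, (X.spanImage A).subtype, fun _ => rfl⟩

/-- The projection to a quotient. -/
def quotHom (N : Submodule ℤ_[p] X.T) (W : Submodule (OC C) X.ω) (h : N ≤ W.comap X.α) :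
    Hom X (X.quot N W h) := ⟨N.mkQ, W.mkQ, fun _ => rfl⟩

/-- The projection `X → X[p^k]`. -/
def torsionHom (k : ℕ) : Hom X (X.torsion k) := quotHom _ _ _ _

/-- The submodule of `X[p^k]` attached to `A ⊆ T`. -/
def torsionSub (k : ℕ) (A : Submodule ℤ_[p] X.T) : Submodule ℤ_[p] (X.torsion k).T :=
  A.map (X.torsionHom k).f

end SpanImage

section Torsion

variable {X : Triple.{u, v, w} p C} {k : ℕ} {A B : Submodule ℤ_[p] X.T}

theorem torsionHom_eq_zero_iff {t : X.T} :
    (X.torsionHom k).f t = 0 ↔ t ∈ (p : ℤ_[p]) ^ k • (⊤ : Submodule ℤ_[p] X.T) := by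
  rw [smul_top_eq_range_lsmul]
  exact Submodule.Quotient.mk_eq_zero _

theorem torsionHom_mem_torsionSub (hA : (p : ℤ_[p]) ^ k • ⊤ ≤ A) {t : X.T} :
    (X.torsionHom k).f t ∈ X.torsionSub k A ↔ t ∈ A := by
  refine ⟨?_, Submodule.mem_map_of_mem⟩
  rintro ⟨a, ha, h⟩
  have hsub : t - a ∈ (p : ℤ_[p]) ^ k • (⊤ : Submodule ℤ_[p] X.T) := by
    rw [← torsionHom_eq_zero_iff, map_sub, h, sub_self]
  simpa using A.add_mem (hA hsub) ha

theorem exists_eq_torsionSub (k : ℕ) (N : Submodule ℤ_[p] (X.torsion k).T) :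
    ∃ A, (p : ℤ_[p]) ^ k • ⊤ ≤ A ∧ N = X.torsionSub k A := by
  refine ⟨N.comap (X.torsionHom k).f, fun t ht => ?_,
    (Submodule.map_comap_eq_of_surjective (Submodule.mkQ_surjective _) N).symm⟩
  rw [Submodule.mem_comap, torsionHom_eq_zero_iff.2 ht]
  exact N.zero_mem

theorem torsionSub_le_iff (hB : (p : ℤ_[p]) ^ k • ⊤ ≤ B) :
    X.torsionSub k A ≤ X.torsionSub k B ↔ A ≤ B :=
  ⟨fun h _ ht => (torsionHom_mem_torsionSub hB).1 (h (Submodule.mem_map_of_mem ht)),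
    Submodule.map_mono⟩

theorem torsionSub_eq_bot_iff : X.torsionSub k A = ⊥ ↔ A ≤ (p : ℤ_[p]) ^ k • ⊤ := by
  rw [torsionSub, ← le_bot_iff, Submodule.map_le_iff_le_comap]
  exact ⟨fun h t ht => torsionHom_eq_zero_iff.1 (by simpa using h ht),
    fun h t ht => by simpa using torsionHom_eq_zero_iff.2 (h ht)⟩

end Torsion

variable (X : Triple.{u, v, w} p C)

/-- `deg(ω/𝒪α(A))`. -/
def codeg (A : Submodule ℤ_[p] X.T) : ℝ := codegree p (X.spanImage A)

/-- The rank of `T`. -/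
abbrev rkT : ℕ := Module.finrank ℤ_[p] X.T

/-- The rank of `ω`. -/
abbrev rkω : ℕ := Module.finrank (OC C) X.ω

section Integral

variable [hX : Fact X.IsIntegral]

instance : Module.Free ℤ_[p] X.T := hX.out.free_T
instance : Module.Finite ℤ_[p] X.T := hX.out.finite_T
instance : Module.Free (OC C) X.ω := hX.out.free_ω
instance : Module.Finite (OC C) X.ω := hX.out.finite_ω

theorem isLattice_spanImage {A : Submodule ℤ_[p] X.T} (hA : IsFull (p : ℤ_[p]) A) :
    IsLattice (p : OC C) (X.spanImage A) := by
  obtain ⟨k, hk⟩ := hA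
  refine ⟨X.spanImage_fg A, k, ?_⟩
  rw [← hX.out.span_eq_top, ← spanImage_prime_pow_smul]
  exact X.spanImage_mono hk

theorem codeg_top : X.codeg ⊤ = 0 := by
  rw [codeg, hX.out.span_eq_top, codegree_top]

theorem codeg_prime_pow_smul {A : Submodule ℤ_[p] X.T} (hA : IsFull (p : ℤ_[p]) A) (k : ℕ) :
    X.codeg ((p : ℤ_[p]) ^ k • A) = X.codeg A + k * X.rkω := by
  rw [codeg, spanImage_prime_pow_smul, codegree_prime_pow_smul (X.isLattice_spanImage hA), codeg]

theorem codeg_prime_smul {A : Submodule ℤ_[p] X.T} (hA : IsFull (p : ℤ_[p]) A) :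
    X.codeg ((p : ℤ_[p]) • A) = X.codeg A + X.rkω := by
  simpa using X.codeg_prime_pow_smul hA 1

theorem codeg_prime_pow_smul_top (k : ℕ) :
    X.codeg ((p : ℤ_[p]) ^ k • ⊤) = k * X.rkω := by
  rw [X.codeg_prime_pow_smul isFull_top, codeg_top, zero_add]

theorem codeg_add_le {A B : Submodule ℤ_[p] X.T} (hA : IsFull (p : ℤ_[p]) A)
    (hB : IsFull (p : ℤ_[p]) B) :
    X.codeg A + X.codeg B ≤ X.codeg (A ⊔ B) + X.codeg (A ⊓ B) := by
  rw [codeg, codeg, codeg, codeg, spanImage_sup]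
  exact codegree_add_le (X.isLattice_spanImage (hA.inf hB)) (X.spanImage_fg A)
    (X.spanImage_fg B) (X.spanImage_mono inf_le_left) (X.spanImage_mono inf_le_right)

theorem codeg_eq_add {A B : Submodule ℤ_[p] X.T} (hA : IsFull (p : ℤ_[p]) A) (h : A ≤ B) :
    X.codeg A = X.codeg B +
      degree p C (X.spanImage B ⧸ (X.spanImage A).submoduleOf (X.spanImage B)) :=
  codegree_eq_add (X.isLattice_spanImage hA) (X.spanImage_fg B) (X.spanImage_mono h)

theorem codeg_le {A B : Submodule ℤ_[p] X.T} (hA : IsFull (p : ℤ_[p]) A) (h : A ≤ B) :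
    X.codeg B ≤ X.codeg A :=
  codegree_le (X.isLattice_spanImage hA) (X.spanImage_fg B) (X.spanImage_mono h)

theorem codeg_le_of_prime_pow_smul_top_le {k : ℕ} {A : Submodule ℤ_[p] X.T}
    (hA : (p : ℤ_[p]) ^ k • ⊤ ≤ A) : X.codeg A ≤ k * X.rkω :=
  X.codeg_prime_pow_smul_top k ▸ X.codeg_le (isFull_pow_smul_top k) hA

theorem coheight_prime_pow_smul_top (k : ℕ) :
    coheight p ((p : ℤ_[p]) ^ k • (⊤ : Submodule ℤ_[p] X.T)) = k * X.rkT := by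
  rw [coheight_prime_pow_smul isFull_top, coheight_top, zero_add]

theorem torsionHeight_torsionSub {k : ℕ} {A : Submodule ℤ_[p] X.T}
    (hA : (p : ℤ_[p]) ^ k • ⊤ ≤ A) :
    ((X.torsion k).sub (X.torsionSub k A)).torsionHeight = k * X.rkT - coheight p A := by
  have hadd := coheight_eq_add (isFull_pow_smul_top k) hA
  rw [coheight_prime_pow_smul_top] at hadd
  rw [torsionHeight, hadd, add_sub_cancel_left, smul_top_eq_range_lsmul]
  exact congrArg (fun n : ℕ => Real.logb p n) (Nat.card_congr (mapMkQEquiv _ A).toEquiv).symm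

theorem degree_torsionSub {k : ℕ} {A : Submodule ℤ_[p] X.T} (hA : (p : ℤ_[p]) ^ k • ⊤ ≤ A) :
    degree p C ((X.torsion k).sub (X.torsionSub k A)).ω = k * X.rkω - X.codeg A := by
  have hadd := X.codeg_eq_add (isFull_pow_smul_top k) hA
  rw [X.codeg_prime_pow_smul_top] at hadd
  rw [hadd, add_sub_cancel_left, spanImage_prime_pow_smul, hX.out.span_eq_top,
    smul_top_eq_range_lsmul]
  change degree p C ((X.torsion k).spanImage (X.torsionSub k A)) = _
  rw [torsionSub, ← Hom.map_spanImage]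
  exact (degree_congr (mapMkQEquiv _ (X.spanImage A))).symm

theorem torsionSlope_torsionSub {k : ℕ} {A : Submodule ℤ_[p] X.T}
    (hA : (p : ℤ_[p]) ^ k • ⊤ ≤ A) :
    ((X.torsion k).sub (X.torsionSub k A)).torsionSlope =
      ((k * X.rkT - coheight p A) - (k * X.rkω - X.codeg A)) / (k * X.rkT - coheight p A) := by
  rw [torsionSlope, torsionDegree, torsionHeight_torsionSub X hA, degree_torsionSub X hA]

/-- The function `A ↦ (1 - μ) ht(T/A) - deg(ω/𝒪α(A))`: when `A` contains `p^k T`, it compares the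
slope of `A/p^k T ⊆ X[p^k]` with `μ`. -/
def slopeFun (μ : ℝ) (A : Submodule ℤ_[p] X.T) : ℝ := (1 - μ) * coheight p A - X.codeg A

/-- The value of `slopeFun` at `pT`. -/
def slopeConst (μ : ℝ) : ℝ := (1 - μ) * X.rkT - X.rkω

/-- `μ` is the largest slope of a nonzero subobject of `X[p]`. -/
structure IsMaxSlope (μ : ℝ) : Prop where
  le_one : μ ≤ 1
  le_slopeFun : ∀ A, (p : ℤ_[p]) • ⊤ ≤ A → X.slopeConst μ ≤ X.slopeFun μ A
  exists_eq : ∃ A, (p : ℤ_[p]) • ⊤ < A ∧ X.slopeFun μ A = X.slopeConst μ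

variable {X}

theorem coheight_lt_of_prime_pow_smul_top_lt {k : ℕ} {A : Submodule ℤ_[p] X.T}
    (hA : (p : ℤ_[p]) ^ k • ⊤ < A) : coheight p A < k * X.rkT :=
  X.coheight_prime_pow_smul_top k ▸ coheight_lt (isFull_pow_smul_top k) hA

theorem torsionSlope_torsionSub_eq (μ : ℝ) {k : ℕ} {A : Submodule ℤ_[p] X.T}
    (hA : (p : ℤ_[p]) ^ k • ⊤ < A) :
    ((X.torsion k).sub (X.torsionSub k A)).torsionSlope =
      μ + (k * X.slopeConst μ - X.slopeFun μ A) / (k * X.rkT - coheight p A) := by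
  have hne := (sub_pos.2 (coheight_lt_of_prime_pow_smul_top_lt hA)).ne'
  rw [torsionSlope_torsionSub X hA.le, slopeConst, slopeFun]
  field_simp
  ring

theorem IsMaxSlope.isSlopeFunction {μ : ℝ} (hμ : X.IsMaxSlope μ) :
    IsSlopeFunction (p : ℤ_[p]) (X.slopeFun μ) (X.slopeConst μ) where
  sup_add_inf_le A B hA hB := by
    have hcodeg := X.codeg_add_le hA hB
    have hcoheight := congrArg ((1 - μ) * ·) (coheight_sup_add_inf hA hB)
    simp only [mul_add] at hcoheight
    simp only [slopeFun]
    linarith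
  smul A hA := by
    rw [slopeFun, coheight_prime_smul hA, X.codeg_prime_smul hA, slopeFun, slopeConst]
    ring
  top := by simp [slopeFun, coheight_top, codeg_top]
  le_of_smul_top_le := hμ.le_slopeFun

theorem IsMaxSlope.prime_pow_smul_top_lt {μ : ℝ} (hμ : X.IsMaxSlope μ)
    {Y : ℕ → Submodule ℤ_[p] X.T}
    (hY : IsSlopeFiltration (p : ℤ_[p]) (X.slopeFun μ) (X.slopeConst μ) Y) {k : ℕ} (hk : 1 ≤ k) :
    (p : ℤ_[p]) ^ k • ⊤ < Y k := by
  obtain ⟨A, hA, hA'⟩ := hμ.exists_eq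
  obtain ⟨j, rfl⟩ := Nat.exists_eq_add_of_le hk
  have hpow : (p : ℤ_[p]) ^ (1 + j) • (⊤ : Submodule ℤ_[p] X.T) =
      (p : ℤ_[p]) ^ j • (p : ℤ_[p]) • ⊤ := by rw [add_comm, pow_succ, mul_smul]
  have hle : (p : ℤ_[p]) ^ j • A ≤ Y (1 + j) := by
    refine hY.le_of_apply_le _ _ (hpow ▸ smul_mono_right _ hA.le) (le_of_eq ?_)
    rw [hμ.isSlopeFunction.pow_smul ⟨1, by simpa using hA.le⟩, hA']
    push_cast
    ring
  refine (hY.pow_smul_top_le _).lt_of_ne fun heq => hA.not_ge fun t ht => ?_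
  rw [← smul_mem_smul_iff (prime_pow_ne_zero j), ← hpow, heq]
  exact hle (Submodule.smul_mem_pointwise_smul t _ _ ht)

theorem IsMaxSlope.isFirstStep {μ : ℝ} (hμ : X.IsMaxSlope μ) {Y : ℕ → Submodule ℤ_[p] X.T}
    (hY : IsSlopeFiltration (p : ℤ_[p]) (X.slopeFun μ) (X.slopeConst μ) Y) {k : ℕ} (hk : 1 ≤ k) :
    (X.torsion k).IsFirstStep (X.torsionSub k (Y k)) := by
  have hlt := hμ.prime_pow_smul_top_lt hY hk
  refine ⟨fun h => hlt.not_ge (torsionSub_eq_bot_iff.1 h), fun N hN => ?_⟩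
  obtain ⟨B, hB, rfl⟩ := exists_eq_torsionSub k N
  have hBlt : (p : ℤ_[p]) ^ k • ⊤ < B := hB.lt_of_ne fun h => hN (torsionSub_eq_bot_iff.2 h.ge)
  have hpos := sub_pos.2 (coheight_lt_of_prime_pow_smul_top_lt hBlt)
  rw [torsionSlope_torsionSub_eq μ hlt, torsionSlope_torsionSub_eq μ hBlt, hY.apply_eq, sub_self,
    zero_div, add_zero]
  refine ⟨add_le_of_nonpos_right (div_nonpos_of_nonpos_of_nonneg
    (sub_nonpos.2 (hμ.isSlopeFunction.le hB)) hpos.le), fun h => ?_⟩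
  rw [add_eq_left, div_eq_zero_iff, or_iff_left hpos.ne', sub_eq_zero] at h
  exact (torsionSub_le_iff (hY.pow_smul_top_le k)).2 (hY.le_of_apply_le k B hB h.ge)

theorem finite_setOf_prime_smul_top_le :
    {A : Submodule ℤ_[p] X.T | (p : ℤ_[p]) • ⊤ ≤ A}.Finite := by
  have : Finite (X.T ⧸ (p : ℤ_[p]) • (⊤ : Submodule ℤ_[p] X.T)) :=
    finite_quotient_prime_smul_top p X.T
  have : Finite (Submodule ℤ_[p] (X.T ⧸ (p : ℤ_[p]) • (⊤ : Submodule ℤ_[p] X.T))) :=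
    Finite.of_injective _ SetLike.coe_injective
  refine (Set.finite_range (Submodule.comap ((p : ℤ_[p]) • (⊤ : Submodule ℤ_[p] X.T)).mkQ)).subset
    fun A hA => ⟨A.map ((p : ℤ_[p]) • (⊤ : Submodule ℤ_[p] X.T)).mkQ, ?_⟩
  rw [Submodule.comap_map_mkQ, sup_eq_right.2 hA]

theorem prime_smul_top_lt [Nontrivial X.T] : (p : ℤ_[p]) • (⊤ : Submodule ℤ_[p] X.T) < ⊤ := by
  refine lt_top_iff_ne_top.2 fun h => ?_
  have hrank := X.coheight_prime_pow_smul_top 1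
  rw [pow_one, h, coheight_top, Nat.cast_one, one_mul] at hrank
  have hpos : 0 < X.rkT := Module.finrank_pos
  exact hpos.ne (by exact_mod_cast hrank)

theorem exists_isMaxSlope [Nontrivial X.T] : ∃ μ, X.IsMaxSlope μ := by
  let σ : Submodule ℤ_[p] X.T → ℝ := fun A => (X.rkω - X.codeg A) / (X.rkT - coheight p A)
  have hfin : {A : Submodule ℤ_[p] X.T | (p : ℤ_[p]) • ⊤ < A}.Finite :=
    finite_setOf_prime_smul_top_le.subset fun A (hA : _ < A) => hA.le
  obtain ⟨A, hA, hmin⟩ := hfin.exists_minimalFor σ _ ⟨⊤, prime_smul_top_lt⟩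
  have hpos (B : Submodule ℤ_[p] X.T) (hB : (p : ℤ_[p]) • ⊤ < B) : 0 < X.rkT - coheight p B := by
    simpa using coheight_lt_of_prime_pow_smul_top_lt (k := 1) (by simpa using hB)
  refine ⟨1 - σ A, ?_, fun B hB => ?_, A, hA, ?_⟩
  · have hcodeg : X.codeg A ≤ X.rkω := by
      simpa using X.codeg_le_of_prime_pow_smul_top_le (k := 1) (by simpa using le_of_lt hA)
    exact sub_le_self _ (div_nonneg (sub_nonneg.2 hcodeg) (hpos A hA).le)
  · simp only [slopeConst, slopeFun, sub_sub_cancel]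
    rcases hB.eq_or_lt with rfl | hB
    · rw [coheight_prime_smul isFull_top, X.codeg_prime_smul isFull_top, coheight_top, codeg_top,
        zero_add, zero_add]
    · have hσ : σ A ≤ σ B := (le_total (σ A) (σ B)).elim id (hmin hB)
      rw [le_div_iff₀ (hpos B hB)] at hσ
      linarith
  · have hσ : σ A * (X.rkT - coheight p A) = X.rkω - X.codeg A :=
      div_mul_cancel₀ _ (hpos A hA).ne'
    simp only [slopeConst, slopeFun]
    linarith

end Integral

end Triple

/-! ### Discreteness of the slopes -/

section Discrete

theorem finite_of_finite_fract_of_subset_Icc {s : Set ℝ} {a b : ℝ}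
    (hfract : (Int.fract '' s).Finite) (hs : s ⊆ Set.Icc a b) : s.Finite := by
  refine (Set.Finite.image2 (fun f (n : ℤ) => (n + f : ℝ)) hfract (Set.finite_Icc ⌊a⌋ ⌊b⌋)).subset
    fun x hx => ?_
  exact ⟨_, Set.mem_image_of_mem _ hx, ⌊x⌋, ⟨Int.floor_mono (hs hx).1, Int.floor_mono (hs hx).2⟩,
    Int.floor_add_fract x⟩

theorem fract_sub_eq_fract_fract_sub_fract (x y : ℝ) :
    Int.fract (x - y) = Int.fract (Int.fract x - Int.fract y) := by
  refine Int.fract_eq_fract.2 ⟨⌊x⌋ - ⌊y⌋, ?_⟩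
  rw [Int.fract, Int.fract]
  push_cast
  ring

theorem prod_mem_pow {K A : Type*} [CommSemiring K] [CommSemiring A] [Algebra K A]
    {U : Submodule K A} {ι : Type*} (s : Finset ι) (f : ι → A) (hf : ∀ i ∈ s, f i ∈ U) :
    ∏ i ∈ s, f i ∈ U ^ s.card := by
  classical
  induction s using Finset.induction_on with
  | empty => simpa using ⟨1, map_one (algebraMap K A)⟩
  | insert i s hi ih =>
    rw [Finset.prod_insert hi, Finset.card_insert_of_notMem hi, pow_succ']
    exact Submodule.mul_mem_mul (hf i (Finset.mem_insert_self i s))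
      (ih fun j hj => hf j (Finset.mem_insert_of_mem hj))

variable {p : ℕ} [hp : Fact p.Prime] {C : Type w} [NormedField C] [NormedAlgebra ℚ_[p] C]

theorem fract_neg_logb_norm_smul {a : ℚ_[p]} (ha : a ≠ 0) {x : C} (hx : x ≠ 0) :
    Int.fract (-Real.logb p ‖a • x‖) = Int.fract (-Real.logb p ‖x‖) := by
  rw [norm_smul, Real.logb_mul (norm_ne_zero_iff.2 ha) (norm_ne_zero_iff.2 hx),
    Padic.norm_eq_zpow_neg_valuation ha, ← Real.rpow_intCast,
    Real.logb_rpow (by linarith [one_lt_prime_cast p]) (one_lt_prime_cast p).ne', neg_add,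
    ← Int.cast_neg, Int.fract_intCast_add]

variable [IsUltrametricDist C]

theorem linearIndependent_of_injective_fract_neg_logb_norm {ι : Type*} {x : ι → C}
    (hx : ∀ i, x i ≠ 0) (hinj : Function.Injective fun i => Int.fract (-Real.logb p ‖x i‖)) :
    LinearIndependent ℚ_[p] x := by
  classical
  rw [linearIndependent_iff']
  intro s g hsum i hi
  by_contra hgi
  have hsupp : i ∈ s.filter (g · ≠ 0) := Finset.mem_filter.2 ⟨hi, hgi⟩
  -- The nonzero terms have pairwise distinct norms, so the largest one is the norm of the sum.
  have hsup := IsUltrametricDist.norm_sum_eq_sup'_of_pairwise_ne ⟨i, hsupp⟩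
    (f := fun j => g j • x j) fun j hj k hk hjk h => hjk <| hinj <| by
      have hj := (Finset.mem_filter.1 hj).2
      have hk := (Finset.mem_filter.1 hk).2
      simp only
      rw [← fract_neg_logb_norm_smul hj (hx j), ← fract_neg_logb_norm_smul hk (hx k), h]
  have hfilter : ∑ j ∈ s with g j ≠ 0, g j • x j = ∑ j ∈ s, g j • x j :=
    Finset.sum_filter_of_ne fun j _ h hgj => h (by rw [hgj, zero_smul])
  rw [hfilter, hsum, norm_zero] at hsup
  have hle := hsup ▸ Finset.le_sup' (fun j => ‖g j • x j‖) hsupp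
  exact smul_ne_zero hgi (hx i) (norm_le_zero_iff.1 hle)

theorem finite_fract_neg_logb_norm (U : Submodule ℚ_[p] C) [FiniteDimensional ℚ_[p] U] :
    ((fun x : C => Int.fract (-Real.logb p ‖x‖)) '' {x | x ∈ U ∧ x ≠ 0}).Finite := by
  let S := (fun x : C => Int.fract (-Real.logb p ‖x‖)) '' {x | x ∈ U ∧ x ≠ 0}
  choose x hx hxs using fun s : S => s.2
  have hli : LinearIndependent ℚ_[p] x := linearIndependent_of_injective_fract_neg_logb_norm
    (fun s => (hx s).2) fun s t h => Subtype.ext ((hxs s).symm.trans (h.trans (hxs t)))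
  have : Finite S := (LinearIndependent.of_comp (v := fun s => (⟨x s, (hx s).1⟩ : U))
    U.subtype hli).finite
  exact Set.toFinite S

variable {W : Type*} [AddCommGroup W] [Module (OC C) W]

theorem coe_det_mem_pow {n : ℕ} (b : Module.Basis (Fin n) (OC C) W) {U : Submodule ℚ_[p] C}
    {x : Fin n → W} (hU : ∀ i j, ((b.repr (x i) j : OC C) : C) ∈ U) :
    ((b.det x : OC C) : C) ∈ U ^ n := by
  rw [Module.Basis.det_apply, Matrix.det_apply]
  simp only [AddSubmonoidClass.coe_finsetSum]
  refine Submodule.sum_mem _ fun σ _ => ?_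
  have hprod : ((∏ i, b.toMatrix x (σ i) i : OC C) : C) ∈ U ^ n := by
    simpa using prod_mem_pow Finset.univ
      (fun i => ((b.toMatrix x (σ i) i : OC C) : C)) fun i _ => hU i (σ i)
  rcases Int.units_eq_one_or (Equiv.Perm.sign σ) with hσ | hσ
  · rwa [hσ, one_smul]
  · rw [hσ, Units.neg_smul, one_smul]
    exact Submodule.neg_mem _ hprod

variable [Module.Free (OC C) W] [Module.Finite (OC C) W]

theorem IsLattice.exists_codegree_eq_of_span {M : Submodule (OC C) W}
    (hM : IsLattice (p : OC C) M) {n : ℕ} (b : Module.Basis (Fin n) (OC C) W) {ι : Type*}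
    {f : ι → W} (hf : Submodule.span (OC C) (Set.range f) = M) :
    ∃ a : Fin n → ι, b.det (f ∘ a) ≠ 0 ∧
      codegree p M = -Real.logb p ‖((b.det (f ∘ a) : OC C) : C)‖ := by
  obtain rfl : n = Module.finrank (OC C) W := by simpa using (Module.finrank_eq_card_basis b).symm
  obtain ⟨m₀⟩ := hM.exists_basis prime_cast_ne_zero
  have := Module.Free.of_basis m₀
  have := Module.Finite.of_basis m₀
  have := Module.finitePresentation_of_projective (OC C) M
  obtain ⟨κ, a, m, hm⟩ := Module.exists_basis_of_span_of_flat
    (fun i => (⟨f i, hf ▸ Submodule.subset_span ⟨i, rfl⟩⟩ : M)) (by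
      apply Submodule.map_injective_of_injective M.injective_subtype
      rw [Submodule.map_span, Submodule.map_subtype_top, ← Set.range_comp]
      exact hf)
  let e := m.indexEquiv m₀
  have hcoe : f ∘ a ∘ e.symm = fun i => ((m.reindex e) i : W) := by
    ext i
    simp [hm]
  refine ⟨a ∘ e.symm, ?_, ?_⟩ <;> rw [hcoe]
  · exact hM.isFull.det_ne_zero prime_cast_ne_zero b _
  · exact codegree_of_basis b _

end Discrete

namespace Triple

variable {p : ℕ} [hp : Fact p.Prime] {C : Type w} [NormedField C] [IsUltrametricDist C]
  [NormedAlgebra ℚ_[p] C] (X : Triple.{u, v, w} p C)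

theorem coe_repr_α_mem_span {ι κ : Type*} [Finite κ] (b : Module.Basis ι (OC C) X.ω)
    (e : Module.Basis κ ℤ_[p] X.T) (t : X.T) (i : ι) :
    ((b.repr (X.α t) i : OC C) : C) ∈ Submodule.span ℚ_[p]
      (Set.range fun jk : κ × ι => ((b.repr (X.α (e jk.1)) jk.2 : OC C) : C)) := by
  have := Fintype.ofFinite κ
  rw [← e.sum_repr t]
  simp only [map_sum, α_smul, map_smul, Finsupp.coe_finsetSum, Finset.sum_apply,
    Finsupp.smul_apply, smul_eq_mul, AddSubmonoidClass.coe_finsetSum, MulMemClass.coe_mul]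
  refine Submodule.sum_mem _ fun j _ => ?_
  have hsmul : ((zpToOC C p (e.repr t j) : OC C) : C) * ((b.repr (X.α (e j)) i : OC C) : C) =
      ((e.repr t j : ℤ_[p]) : ℚ_[p]) • ((b.repr (X.α (e j)) i : OC C) : C) :=
    (Algebra.smul_def _ _).symm
  exact hsmul ▸ Submodule.smul_mem _ _ (Submodule.subset_span ⟨(j, i), rfl⟩)

variable [hX : Fact X.IsIntegral]

theorem finite_fract_codeg :
    ((fun A => Int.fract (X.codeg A)) '' {A | IsFull (p : ℤ_[p]) A}).Finite := by
  let b := Module.finBasis (OC C) X.ω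
  let e := Module.finBasis ℤ_[p] X.T
  let U : Submodule ℚ_[p] C := Submodule.span ℚ_[p]
    (Set.range fun jk : Fin X.rkT × Fin X.rkω => ((b.repr (X.α (e jk.1)) jk.2 : OC C) : C))
  have hU : U.FG := Submodule.fg_span (Set.finite_range _)
  have : FiniteDimensional ℚ_[p] (U ^ X.rkω : Submodule ℚ_[p] C) :=
    Module.Finite.iff_fg.2 (hU.pow _)
  refine (finite_fract_neg_logb_norm (U ^ X.rkω)).subset ?_
  rintro _ ⟨A, hA, rfl⟩
  obtain ⟨a, hdet, hcodeg⟩ := (X.isLattice_spanImage hA).exists_codegree_eq_of_span b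
    (f := fun t : A => X.α t) (by rw [spanImage, Set.image_eq_range]; rfl)
  refine ⟨_, ⟨coe_det_mem_pow b fun i j => X.coe_repr_α_mem_span b e (a i) j, ?_⟩,
    congrArg Int.fract hcodeg.symm⟩
  simpa using show b.det (fun i => X.α (a i)) ≠ 0 from hdet

theorem finite_codeg_sub : {c | ∃ A B, IsFull (p : ℤ_[p]) A ∧ (p : ℤ_[p]) • A ≤ B ∧ B ≤ A ∧
    X.codeg B - X.codeg A = c}.Finite := by
  refine finite_of_finite_fract_of_subset_Icc (a := 0) (b := X.rkω) ?_ ?_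
  · refine (X.finite_fract_codeg.image2 (fun x y => Int.fract (x - y))
      X.finite_fract_codeg).subset ?_
    rintro _ ⟨_, ⟨A, B, hA, hAB, -, rfl⟩, rfl⟩
    exact ⟨_, ⟨B, hA.smul.mono hAB, rfl⟩, _, ⟨A, hA, rfl⟩,
      (fract_sub_eq_fract_fract_sub_fract _ _).symm⟩
  · rintro _ ⟨A, B, hA, hAB, hBA, rfl⟩
    have hle := X.codeg_le hA.smul hAB
    rw [X.codeg_prime_smul hA] at hle
    exact ⟨sub_nonneg.2 (X.codeg_le (hA.smul.mono hAB) hBA), by linarith⟩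

theorem finite_coheight_sub : {c | ∃ A B : Submodule ℤ_[p] X.T, IsFull (p : ℤ_[p]) A ∧
    (p : ℤ_[p]) • A ≤ B ∧ B ≤ A ∧ coheight p B - coheight p A = c}.Finite := by
  refine ((Set.finite_Icc (0 : ℤ) X.rkT).image (Int.cast (R := ℝ))).subset ?_
  rintro _ ⟨A, B, hA, hAB, hBA, rfl⟩
  obtain ⟨i, hi⟩ := hA.exists_coheight_eq_natCast
  obtain ⟨j, hj⟩ := (hA.smul.mono hAB).exists_coheight_eq_natCast
  have hle := coheight_le hA.smul hAB
  have hge := coheight_le (hA.smul.mono hAB) hBA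
  rw [coheight_prime_smul hA] at hle
  rw [hi, hj] at hle hge ⊢
  refine ⟨j - i, ⟨sub_nonneg.2 (by exact_mod_cast hge), ?_⟩, by push_cast; rfl⟩
  rw [sub_le_iff_le_add']
  exact_mod_cast hle

/-- The slope of `B/pA`, for `pA ⊆ B ⊆ A`. -/
def relSlope (A B : Submodule ℤ_[p] X.T) : ℝ :=
  1 - (X.rkω - (X.codeg B - X.codeg A)) / (X.rkT - (coheight p B - coheight p A))

/-- The slopes of the subobjects of all `Z[p]`, for `Z = (A, 𝒪_C · α(A), α)` with `A` full in `T`.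
Up to isomorphism, these `Z` are all the modules isogenous to `X`. -/
def relSlopes : Set ℝ :=
  {s | ∃ A B, IsFull (p : ℤ_[p]) A ∧ (p : ℤ_[p]) • A ≤ B ∧ B ≤ A ∧ X.relSlope A B = s}

theorem finite_relSlopes : X.relSlopes.Finite := by
  refine (X.finite_codeg_sub.image2 (fun c h : ℝ => 1 - (X.rkω - c) / (X.rkT - h))
    X.finite_coheight_sub).subset ?_
  rintro _ ⟨A, B, hA, hAB, hBA, rfl⟩
  exact ⟨_, ⟨A, B, hA, hAB, hBA, rfl⟩, _, ⟨A, B, hA, hAB, hBA, rfl⟩, rfl⟩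

variable {X}

theorem IsMaxSlope.mem_relSlopes {μ : ℝ} (hμ : X.IsMaxSlope μ) : μ ∈ X.relSlopes := by
  obtain ⟨A, hA, h⟩ := hμ.exists_eq
  refine ⟨⊤, A, isFull_top, hA.le, le_top, ?_⟩
  have hpos : 0 < X.rkT - coheight p A := by
    simpa using coheight_lt_of_prime_pow_smul_top_lt (k := 1) (by simpa using hA)
  rw [slopeFun, slopeConst] at h
  have hcodeg : X.rkω - X.codeg A = (1 - μ) * (X.rkT - coheight p A) := by linarith
  rw [relSlope, codeg_top, coheight_top, sub_zero, sub_zero, hcodeg,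
    mul_div_cancel_right₀ _ hpos.ne', sub_sub_cancel]

end Triple

/-! ### Saturation and quotients -/

section Saturation

variable {R : Type*} [CommRing R] {a : R} {W : Type*} [AddCommGroup W] [Module R W]

theorem IsSaturated.isTorsionFree_quotient [IsDomain R] (ha : ∀ c : R, c ≠ 0 → ∃ n, c ∣ a ^ n)
    {M : Submodule R W} (hM : IsSaturated a M) : Module.IsTorsionFree R (W ⧸ M) := by
  refine Module.IsTorsionFree.of_smul_eq_zero fun c x hcx => or_iff_not_imp_left.2 fun hc => ?_
  obtain ⟨x, rfl⟩ := M.mkQ_surjective x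
  obtain ⟨n, d, hd⟩ := ha c hc
  rw [Submodule.mkQ_apply, ← Submodule.Quotient.mk_smul, Submodule.Quotient.mk_eq_zero] at hcx
  refine (Submodule.Quotient.mk_eq_zero _).2 (hM.mem_of_pow_smul_mem (k := n) ?_)
  rw [hd, mul_comm, mul_smul]
  exact M.smul_mem d hcx

theorem IsSaturated.free_quotient [IsDomain R] [ValuationRing R] [Module.Finite R W]
    (ha : ∀ c : R, c ≠ 0 → ∃ n, c ∣ a ^ n) {M : Submodule R W} (hM : IsSaturated a M) :
    Module.Free R (W ⧸ M) := by
  have := hM.isTorsionFree_quotient ha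
  exact free_of_finite_isTorsionFree

theorem IsSaturated.fg [IsDomain R] [ValuationRing R] [Module.Finite R W]
    (ha : ∀ c : R, c ≠ 0 → ∃ n, c ∣ a ^ n) {M : Submodule R W} (hM : IsSaturated a M) : M.FG := by
  have := hM.free_quotient ha
  have := Module.finitePresentation_of_projective R (W ⧸ M)
  simpa using Module.FinitePresentation.fg_ker M.mkQ M.mkQ_surjective

/-- The `a`-saturation of `M` in `W`: the elements that a power of `a` multiplies into `M`. -/
def saturation (a : R) (M : Submodule R W) : Submodule R W :=
  (Submodule.torsion' R (W ⧸ M) (Submonoid.powers a)).comap M.mkQ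

theorem mem_saturation {M : Submodule R W} {x : W} :
    x ∈ saturation a M ↔ ∃ n : ℕ, a ^ n • x ∈ M := by
  simp only [saturation, Submodule.mem_comap, Submodule.mem_torsion'_iff, Subtype.exists,
    Submonoid.mem_powers_iff, Submonoid.mk_smul, exists_prop, exists_exists_eq_and,
    Submodule.mkQ_apply, ← Submodule.Quotient.mk_smul, Submodule.Quotient.mk_eq_zero]

theorem le_saturation (M : Submodule R W) : M ≤ saturation a M :=
  fun _ hx => mem_saturation.2 ⟨0, by simpa using hx⟩

theorem isSaturated_saturation (M : Submodule R W) : IsSaturated a (saturation a M) := by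
  intro x hx
  obtain ⟨n, hn⟩ := mem_saturation.1 hx
  exact mem_saturation.2 ⟨n + 1, by rwa [pow_succ, mul_smul]⟩

theorem exists_pow_smul_mem_of_fg {M : Submodule R W} (h : (saturation a M).FG) :
    ∃ k : ℕ, ∀ x ∈ saturation a M, a ^ k • x ∈ M := by
  obtain ⟨s, hs⟩ := h
  have hmem (x : s) : ∃ n : ℕ, a ^ n • (x : W) ∈ M :=
    mem_saturation.1 (hs ▸ Submodule.subset_span x.2)
  choose n hn using hmem
  refine ⟨∑ x, n x, fun x hx => ?_⟩
  have hle : Submodule.span R (s : Set W) ≤ M.comap (LinearMap.lsmul R W (a ^ ∑ x, n x)) := by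
    refine Submodule.span_le.2 fun x hx => ?_
    obtain ⟨j, hj⟩ := Nat.exists_eq_add_of_le'
      (Finset.single_le_sum (f := n) (fun _ _ => Nat.zero_le _) (Finset.mem_univ ⟨x, hx⟩))
    rw [SetLike.mem_coe, Submodule.mem_comap, LinearMap.lsmul_apply, hj, pow_add, mul_smul]
    exact M.smul_mem _ (hn ⟨x, hx⟩)
  exact hle (hs ▸ hx)

theorem finrank_le_of_pow_smul_mem [IsDomain R] [Module.IsTorsionFree R W] (ha : a ≠ 0)
    (k : ℕ) {M N : Submodule R W} [Module.Finite R M] (h : ∀ x ∈ N, a ^ k • x ∈ M) :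
    Module.finrank R N ≤ Module.finrank R M := by
  let f : N →ₗ[R] M := (LinearMap.lsmul R W (a ^ k)).restrict h
  refine LinearMap.finrank_le_finrank_of_injective (f := f) fun x y hxy => ?_
  exact Subtype.ext (smul_right_injective W (pow_ne_zero k ha) (congrArg Subtype.val hxy))

theorem IsFull.map_subtype {A : Submodule R W} (hA : IsFull a A) {B : Submodule R A}
    (hB : IsFull a B) : IsFull a (B.map A.subtype) := by
  obtain ⟨j, hj⟩ := hA
  obtain ⟨k, hk⟩ := hB
  refine ⟨k + j, ?_⟩
  rw [pow_add, mul_smul]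
  refine (smul_mono_right _ hj).trans ?_
  simpa [Submodule.map_pointwise_smul] using Submodule.map_mono (f := A.subtype) hk

end Saturation

section Valuation

variable {p : ℕ} [hp : Fact p.Prime]

theorem exists_dvd_prime_pow {a : ℤ_[p]} (ha : a ≠ 0) : ∃ n, a ∣ (p : ℤ_[p]) ^ n :=
  ⟨a.valuation, (PadicInt.unitCoeff_spec ha).dvd.trans (Units.mul_left_dvd.2 dvd_rfl)⟩

theorem exists_dvd_prime_pow_OC {C : Type w} [NormedField C] [IsUltrametricDist C]
    [NormedAlgebra ℚ_[p] C] {a : OC C} (ha : a ≠ 0) : ∃ n, a ∣ (p : OC C) ^ n := by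
  obtain ⟨n, hn⟩ := exists_pow_lt_of_lt_one (norm_coe_pos ha)
    (inv_lt_one_of_one_lt₀ (one_lt_prime_cast p))
  have hb : ‖((p : OC C) ^ n : OC C) / (a : C)‖ ≤ 1 := by
    rw [norm_div, div_le_one (norm_coe_pos ha), SubmonoidClass.coe_pow, norm_pow,
      norm_natCast_prime]
    exact hn.le
  exact ⟨n, ⟨_, (mem_OC_iff C _).2 hb⟩,
    Subtype.ext (mul_div_cancel₀ _ (by simpa using ha)).symm⟩

section Coheight

variable {T : Type u} [AddCommGroup T] [Module ℤ_[p] T]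

theorem coheight_comap_of_surjective {T' : Type*} [AddCommGroup T'] [Module ℤ_[p] T']
    {f : T →ₗ[ℤ_[p]] T'} (hf : Function.Surjective f) (N : Submodule ℤ_[p] T') :
    coheight p (N.comap f) = coheight p N :=
  congrArg (fun n : ℕ => Real.logb p n)
    (AddSubgroup.index_comap_of_surjective (f := f.toAddMonoidHom) N.toAddSubgroup hf)

theorem comap_subtype_map_sup_prime_smul_top {E : Submodule ℤ_[p] T}
    (hE : IsSaturated (p : ℤ_[p]) E) {A : Submodule ℤ_[p] E} (hA : (p : ℤ_[p]) • ⊤ ≤ A) :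
    (A.map E.subtype ⊔ (p : ℤ_[p]) • ⊤).comap E.subtype = A := by
  refine le_antisymm (fun e he => ?_) fun a ha =>
    Submodule.mem_sup_left (Submodule.mem_map_of_mem ha)
  obtain ⟨_, ⟨a, ha, rfl⟩, _, ⟨t, -, rfl⟩, h⟩ := Submodule.mem_sup.1 (Submodule.mem_comap.1 he)
  have hpt : (p : ℤ_[p]) • t = (e - a : E) := by
    rw [Submodule.coe_sub]
    exact eq_sub_of_add_eq' h
  have ht : t ∈ E := hE t (hpt ▸ (e - a).2)
  have he : e = a + (p : ℤ_[p]) • (⟨t, ht⟩ : E) := Subtype.ext h.symm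
  exact he ▸ A.add_mem ha (smul_top_le_iff.1 hA _)

variable [Module.Finite ℤ_[p] T]

theorem coheight_sup_prime_pow_smul_top {E : Submodule ℤ_[p] T}
    (hE : IsSaturated (p : ℤ_[p]) E) (k : ℕ) : coheight p (E ⊔ (p : ℤ_[p]) ^ k • ⊤) =
      k * ((Module.finrank ℤ_[p] T : ℝ) - Module.finrank ℤ_[p] E) := by
  have := hE.free_quotient fun _ => exists_dvd_prime_pow
  have hcomap : ((p : ℤ_[p]) ^ k • (⊤ : Submodule ℤ_[p] (T ⧸ E))).comap E.mkQ =
      E ⊔ (p : ℤ_[p]) ^ k • ⊤ := by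
    rw [← Submodule.comap_map_mkQ, Submodule.map_pointwise_smul, Submodule.map_top,
      Submodule.range_mkQ]
  rw [← hcomap, coheight_comap_of_surjective E.mkQ_surjective,
    coheight_prime_pow_smul isFull_top, coheight_top, zero_add, ← E.finrank_quotient_add_finrank]
  push_cast
  ring

variable [Module.Free ℤ_[p] T]

theorem coheight_map_subtype {A : Submodule ℤ_[p] T}
    (hA : IsFull (p : ℤ_[p]) A) {B : Submodule ℤ_[p] A} (hB : IsFull (p : ℤ_[p]) B) :
    coheight p (B.map A.subtype) = coheight p B + coheight p A := by
  have hindex : (B.map A.subtype).toAddSubgroup.index =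
      B.toAddSubgroup.index * A.toAddSubgroup.index :=
    AddSubgroup.index_map_subtype (H := A.toAddSubgroup) B.toAddSubgroup
  rw [coheight, hindex, Nat.cast_mul, Real.logb_mul (by exact_mod_cast hB.index_ne_zero)
    (by exact_mod_cast hA.index_ne_zero), coheight, coheight]

theorem coheight_eq_coheight_sup_add {A : Submodule ℤ_[p] T} (hA : IsFull (p : ℤ_[p]) A)
    (E : Submodule ℤ_[p] T) :
    coheight p A = coheight p (A ⊔ E) + coheight p (A.comap E.subtype) := by
  have hindex := AddSubgroup.relIndex_mul_index
    (Submodule.toAddSubgroup_mono (le_sup_left : A ≤ A ⊔ E))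
  have hrel : A.toAddSubgroup.relIndex (A ⊔ E).toAddSubgroup =
      (A.comap E.subtype).toAddSubgroup.index := by
    rw [Submodule.sup_toAddSubgroup, AddSubgroup.relIndex_sup_left]
    rfl
  have hne := hindex ▸ hA.index_ne_zero
  rw [hrel] at hindex hne
  rw [coheight, ← hindex, Nat.cast_mul, add_comm, Real.logb_mul
    (by exact_mod_cast left_ne_zero_of_mul hne) (by exact_mod_cast right_ne_zero_of_mul hne)]
  rfl

theorem coheight_map_subtype_sup {E : Submodule ℤ_[p] T} (hE : IsSaturated (p : ℤ_[p]) E)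
    {A : Submodule ℤ_[p] E} (hA : (p : ℤ_[p]) • ⊤ ≤ A) :
    coheight p (A.map E.subtype ⊔ (p : ℤ_[p]) • ⊤) =
      coheight p A + ((Module.finrank ℤ_[p] T : ℝ) - Module.finrank ℤ_[p] E) := by
  have hcoheight : coheight p (E ⊔ (p : ℤ_[p]) • ⊤) =
      (Module.finrank ℤ_[p] T : ℝ) - Module.finrank ℤ_[p] E := by
    simpa using coheight_sup_prime_pow_smul_top hE 1
  have hsup : (A.map E.subtype ⊔ (p : ℤ_[p]) • ⊤) ⊔ E = E ⊔ (p : ℤ_[p]) • ⊤ := by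
    rw [sup_right_comm, sup_eq_right.2 (Submodule.map_subtype_le E A)]
  rw [coheight_eq_coheight_sup_add (isFull_top.smul.mono le_sup_right) E, hsup, hcoheight,
    comap_subtype_map_sup_prime_smul_top hE hA, add_comm]

end Coheight

section Codegree

variable {C : Type w} [NormedField C] [IsUltrametricDist C] [NormedAlgebra ℚ_[p] C]
  {W : Type v} [AddCommGroup W] [Module (OC C) W] [Module.Finite (OC C) W]

theorem saturation_fg (M : Submodule (OC C) W) : (saturation (p : OC C) M).FG :=
  (isSaturated_saturation M).fg fun _ => exists_dvd_prime_pow_OC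

theorem codegree_sup_prime_pow_smul_top {N : Submodule (OC C) W}
    (hN : IsSaturated (p : OC C) N) (k : ℕ) :
    codegree p (N ⊔ (p : OC C) ^ k • ⊤) =
      k * ((Module.finrank (OC C) W : ℝ) - Module.finrank (OC C) N) := by
  have := hN.free_quotient fun _ => exists_dvd_prime_pow_OC
  have hmap : ((p : OC C) ^ k • (⊤ : Submodule (OC C) W)).map N.mkQ = (p : OC C) ^ k • ⊤ := by
    rw [Submodule.map_pointwise_smul, Submodule.map_top, Submodule.range_mkQ]
  have hquot : codegree p (N ⊔ (p : OC C) ^ k • ⊤) =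
      codegree p ((p : OC C) ^ k • (⊤ : Submodule (OC C) (W ⧸ N))) :=
    hmap ▸ (degree_congr (Submodule.quotientQuotientEquivQuotientSup N _)).symm
  rw [hquot, codegree_prime_pow_smul isLattice_top, codegree_top, zero_add,
    ← N.finrank_quotient_add_finrank]
  push_cast
  ring

variable [Module.Free (OC C) W] {M : Submodule (OC C) W} (hM : M.FG)
include hM

theorem finrank_saturation :
    Module.finrank (OC C) (saturation (p : OC C) M) = Module.finrank (OC C) M := by
  have := Module.Finite.iff_fg.2 hM
  have := Module.Finite.iff_fg.2 (saturation_fg (p := p) M)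
  obtain ⟨k, hk⟩ := exists_pow_smul_mem_of_fg (saturation_fg (p := p) M)
  exact le_antisymm (finrank_le_of_pow_smul_mem prime_cast_ne_zero k hk)
    (Submodule.finrank_mono (le_saturation M))

theorem le_codegree_sup_prime_pow_smul_top (k : ℕ) :
    k * ((Module.finrank (OC C) W : ℝ) - Module.finrank (OC C) M) ≤
      codegree p (M ⊔ (p : OC C) ^ k • ⊤) := by
  have htop : IsLattice (p : OC C) ((p : OC C) ^ k • (⊤ : Submodule (OC C) W)) :=
    ⟨Module.Finite.fg_top.map _, isFull_pow_smul_top k⟩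
  rw [← finrank_saturation (p := p) hM,
    ← codegree_sup_prime_pow_smul_top (isSaturated_saturation M)]
  exact codegree_le (htop.mono (hM.sup htop.fg) le_sup_right)
    ((saturation_fg M).sup htop.fg) (sup_le_sup_right (le_saturation M) _)

theorem exists_codegree_sup_prime_pow_smul_top_le : ∃ K : ℝ, ∀ k : ℕ,
    codegree p (M ⊔ (p : OC C) ^ k • ⊤) ≤
      k * ((Module.finrank (OC C) W : ℝ) - Module.finrank (OC C) M) + K := by
  obtain ⟨j, hj⟩ := exists_pow_smul_mem_of_fg (saturation_fg (p := p) M)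
  refine ⟨j * Module.finrank (OC C) W, fun k => ?_⟩
  have htop : IsLattice (p : OC C) ((p : OC C) ^ k • (⊤ : Submodule (OC C) W)) :=
    ⟨Module.Finite.fg_top.map _, isFull_pow_smul_top k⟩
  let L := saturation (p : OC C) M ⊔ (p : OC C) ^ k • ⊤
  have hL : IsLattice (p : OC C) L := htop.mono ((saturation_fg M).sup htop.fg) le_sup_right
  have hle : (p : OC C) ^ j • L ≤ M ⊔ (p : OC C) ^ k • ⊤ := by
    rw [Submodule.smul_sup']
    refine sup_le_sup ?_ (Submodule.smul_le_self_of_tower _ _)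
    rintro _ ⟨x, hx, rfl⟩
    exact hj x hx
  have hpL : IsLattice (p : OC C) ((p : OC C) ^ j • L) := ⟨hL.fg.map _, hL.isFull.pow_smul j⟩
  refine (codegree_le hpL (hM.sup htop.fg) hle).trans_eq ?_
  rw [codegree_prime_pow_smul hL, codegree_sup_prime_pow_smul_top (isSaturated_saturation M),
    finrank_saturation hM]

end Codegree

end Valuation

namespace Triple

variable {p : ℕ} [hp : Fact p.Prime] {C : Type w} [NormedField C] [IsUltrametricDist C]
  [NormedAlgebra ℚ_[p] C] {X Y Z : Triple.{u, v, w} p C}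

/-- The composite of two morphisms. -/
def Hom.comp (ψ : Hom Y Z) (φ : Hom X Y) : Hom X Z :=
  ⟨ψ.f ∘ₗ φ.f, ψ.g ∘ₗ φ.g, fun t => by simp [φ.comm, ψ.comm]⟩

/-- The identity morphism. -/
def Hom.id (X : Triple.{u, v, w} p C) : Hom X X := ⟨LinearMap.id, LinearMap.id, fun _ => rfl⟩

/-- The restriction of a morphism to a subobject and its image. -/
def Hom.restrict (φ : Hom X Y) (A : Submodule ℤ_[p] X.T) : Hom (X.sub A) (Y.sub (A.map φ.f)) where
  f := φ.f.submoduleMap A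
  g := φ.g.restrict (p := X.spanImage A) (q := Y.spanImage (A.map φ.f)) fun _ hx =>
    φ.map_spanImage A ▸ Submodule.mem_map_of_mem hx
  comm t := Subtype.ext (φ.comm ((X.subHom A).f t))

theorem Hom.restrict_f_surjective (φ : Hom X Y) (A : Submodule ℤ_[p] X.T) :
    Function.Surjective (φ.restrict A).f := φ.f.submoduleMap_surjective A

theorem Hom.restrict_g_surjective (φ : Hom X Y) (A : Submodule ℤ_[p] X.T) :
    Function.Surjective (φ.restrict A).g := by
  rintro ⟨y, hy⟩
  rw [← φ.map_spanImage A] at hy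
  obtain ⟨x, hx, rfl⟩ := hy
  exact ⟨⟨x, hx⟩, rfl⟩

/-- Multiplication by `p ^ k` from `X` to a subobject that contains `p ^ k T`. -/
def powHom (k : ℕ) (A : Submodule ℤ_[p] X.T) (hA : (p : ℤ_[p]) ^ k • ⊤ ≤ A)
    (hX : X.spanImage ⊤ = ⊤) : Hom X (X.sub A) where
  f := (LinearMap.lsmul ℤ_[p] X.T ((p : ℤ_[p]) ^ k)).codRestrict A (smul_top_le_iff.1 hA)
  g := (LinearMap.lsmul (OC C) X.ω ((p : OC C) ^ k)).codRestrict (X.spanImage A)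
    (smul_top_le_iff.1 (by
      rw [← hX, ← spanImage_prime_pow_smul]
      exact X.spanImage_mono hA))
  comm t := Subtype.ext (X.α_prime_pow_smul k t).symm

theorem submoduleOf_spanImage_map_subtype (A : Submodule ℤ_[p] X.T)
    (B : Submodule ℤ_[p] (X.sub A).T) :
    (X.spanImage (B.map (X.subHom A).f)).submoduleOf (X.spanImage A) = (X.sub A).spanImage B := by
  rw [← Hom.map_spanImage]
  exact Submodule.comap_map_eq_of_injective (X.spanImage A).injective_subtype _

section Integral

variable [hX : Fact X.IsIntegral]

instance sub_isIntegral (A : Submodule ℤ_[p] X.T) : Fact (X.sub A).IsIntegral := by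
  have : Module.Finite (OC C) (X.spanImage A) := Module.Finite.iff_fg.2 (X.spanImage_fg A)
  refine ⟨⟨inferInstanceAs (Module.Free ℤ_[p] A), inferInstanceAs (Module.Finite ℤ_[p] A),
    free_of_finite_isTorsionFree (R := OC C) (W := X.spanImage A), this, ?_⟩⟩
  have htop : (⊤ : Submodule ℤ_[p] (X.sub A).T).map (X.subHom A).f = A :=
    Submodule.map_subtype_top A
  rw [← submoduleOf_spanImage_map_subtype, htop]
  exact Submodule.submoduleOf_self _

theorem rkT_sub {A : Submodule ℤ_[p] X.T} (hA : IsFull (p : ℤ_[p]) A) :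
    (X.sub A).rkT = X.rkT :=
  hA.finrank_eq (pow_one (p : ℤ_[p]) ▸ prime_pow_ne_zero 1)

theorem rkω_sub {A : Submodule ℤ_[p] X.T} (hA : IsFull (p : ℤ_[p]) A) :
    (X.sub A).rkω = X.rkω :=
  have := Module.Finite.iff_fg.2 (X.spanImage_fg A)
  (X.isLattice_spanImage hA).isFull.finrank_eq prime_cast_ne_zero

theorem codeg_map_subtype {A : Submodule ℤ_[p] X.T} (hA : IsFull (p : ℤ_[p]) A)
    {B : Submodule ℤ_[p] (X.sub A).T} (hB : IsFull (p : ℤ_[p]) B) :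
    X.codeg (B.map (X.subHom A).f) = (X.sub A).codeg B + X.codeg A := by
  have hadd : X.codeg (B.map (X.subHom A).f) = X.codeg A + degree p C (X.spanImage A ⧸
      (X.spanImage (B.map (X.subHom A).f)).submoduleOf (X.spanImage A)) :=
    X.codeg_eq_add (hA.map_subtype hB) (Submodule.map_subtype_le A B)
  rw [hadd, submoduleOf_spanImage_map_subtype, add_comm]
  rfl

theorem relSlope_map_subtype {A : Submodule ℤ_[p] X.T} (hA : IsFull (p : ℤ_[p]) A)
    {B D : Submodule ℤ_[p] (X.sub A).T} (hB : IsFull (p : ℤ_[p]) B)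
    (hD : IsFull (p : ℤ_[p]) D) :
    X.relSlope (B.map (X.subHom A).f) (D.map (X.subHom A).f) = (X.sub A).relSlope B D := by
  have hcoheight {E : Submodule ℤ_[p] (X.sub A).T} (hE : IsFull (p : ℤ_[p]) E) :
      coheight p (E.map (X.subHom A).f) = coheight p E + coheight p A :=
    coheight_map_subtype hA hE
  rw [relSlope, codeg_map_subtype hA hB, codeg_map_subtype hA hD, hcoheight hB, hcoheight hD,
    add_sub_add_right_eq_sub, add_sub_add_right_eq_sub, relSlope, rkT_sub hA, rkω_sub hA]

theorem relSlopes_sub_subset {A : Submodule ℤ_[p] X.T} (hA : IsFull (p : ℤ_[p]) A) :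
    (X.sub A).relSlopes ⊆ X.relSlopes := by
  rintro _ ⟨B, D, hB, hBD, hDB, rfl⟩
  refine ⟨B.map (X.subHom A).f, D.map (X.subHom A).f, hA.map_subtype hB, ?_,
    Submodule.map_mono hDB, relSlope_map_subtype hA hB (hB.smul.mono hBD)⟩
  rw [← Submodule.map_pointwise_smul]
  exact Submodule.map_mono hBD

end Integral

section SatQuot

variable (X)

/-- The saturation of `𝒪_C · α(D)` in `ω`. -/
def satImage (D : Submodule ℤ_[p] X.T) : Submodule (OC C) X.ω :=
  saturation (p : OC C) (X.spanImage D)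

theorem spanImage_le_satImage (D : Submodule ℤ_[p] X.T) : X.spanImage D ≤ X.satImage D :=
  le_saturation _

theorem le_comap_satImage (D : Submodule ℤ_[p] X.T) : D ≤ (X.satImage D).comap X.α :=
  fun _ ht => X.spanImage_le_satImage D (X.mem_spanImage ht)

/-- The quotient of `X` by `D` and the saturation of `𝒪_C · α(D)`. -/
def satQuot (D : Submodule ℤ_[p] X.T) : Triple.{u, v, w} p C :=
  X.quot D (X.satImage D) (X.le_comap_satImage D)

/-- The projection to `satQuot`. -/
def satQuotHom (D : Submodule ℤ_[p] X.T) : Hom X (X.satQuot D) := X.quotHom _ _ _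

theorem satQuotHom_f_eq_zero {D : Submodule ℤ_[p] X.T} {t : X.T} :
    (X.satQuotHom D).f t = 0 ↔ t ∈ D := Submodule.Quotient.mk_eq_zero _

theorem satQuotHom_g_eq_zero {D : Submodule ℤ_[p] X.T} {x : X.ω} :
    (X.satQuotHom D).g x = 0 ↔ x ∈ X.satImage D := Submodule.Quotient.mk_eq_zero _

theorem satQuotHom_f_surjective (D : Submodule ℤ_[p] X.T) :
    Function.Surjective (X.satQuotHom D).f := Submodule.mkQ_surjective _

theorem satQuotHom_g_surjective (D : Submodule ℤ_[p] X.T) :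
    Function.Surjective (X.satQuotHom D).g := Submodule.mkQ_surjective _

variable [hX : Fact X.IsIntegral]

theorem satQuot_isIntegral {D : Submodule ℤ_[p] X.T} (hD : IsSaturated (p : ℤ_[p]) D) :
    (X.satQuot D).IsIntegral := by
  refine ⟨hD.free_quotient fun _ => exists_dvd_prime_pow,
    Module.Finite.of_surjective _ D.mkQ_surjective,
    (isSaturated_saturation (X.spanImage D)).free_quotient fun _ => exists_dvd_prime_pow_OC,
    Module.Finite.of_surjective _ (X.satImage D).mkQ_surjective,
    (X.satQuotHom D).spanImage_top_of_surjective (X.satQuotHom_f_surjective D)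
      (X.satQuotHom_g_surjective D) hX.out.span_eq_top⟩

end SatQuot

end Triple

/-! ### The descent step -/

namespace Triple

variable {p : ℕ} [hp : Fact p.Prime] {C : Type w} [NormedField C] [IsUltrametricDist C]
  [NormedAlgebra ℚ_[p] C] {X Z : Triple.{u, v, w} p C}

section Step

theorem descentTerminates_of_subsingleton (h : Subsingleton X.T) : X.DescentTerminates :=
  ⟨0, fun _ => X, rfl, fun _ hi => absurd hi (Nat.not_lt_zero _), h⟩

theorem DescentTerminates.of_isDescentStep (hX : Nontrivial X.T) (hXZ : IsDescentStep X Z)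
    (hZ : Z.DescentTerminates) : X.DescentTerminates := by
  obtain ⟨N, W, rfl, hW, hN⟩ := hZ
  refine ⟨N + 1, fun i => Nat.casesOn i X W, rfl, ?_, hN⟩
  rintro (_ | i) hi
  · exact ⟨hX, hXZ⟩
  · exact hW i (by omega)

theorem Hom.exists_f_eq_prime_pow_smul_iff {A D : Submodule ℤ_[p] X.T} {ρ : Hom (X.sub A) Z}
    (hsurj : Function.Surjective ρ.f) (hf : ∀ t, ρ.f t = 0 ↔ (X.subHom A).f t ∈ D) (k : ℕ)
    {t : (X.sub A).T} :
    (∃ s, ρ.f t = (p : ℤ_[p]) ^ k • s) ↔ (X.subHom A).f t ∈ D ⊔ (p : ℤ_[p]) ^ k • A := by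
  constructor
  · rintro ⟨s, hs⟩
    obtain ⟨y, rfl⟩ := hsurj s
    rw [← map_smul, ← sub_eq_zero, ← map_sub, hf] at hs
    refine Submodule.mem_sup.2 ⟨_, hs, (p : ℤ_[p]) ^ k • (X.subHom A).f y,
      Submodule.smul_mem_pointwise_smul _ _ _ (Subtype.coe_prop y), ?_⟩
    rw [map_sub, map_smul, sub_add_cancel]
  · intro ht
    obtain ⟨d, hd, _, ⟨y, hy, rfl⟩, hdy⟩ := Submodule.mem_sup.1 ht
    let y' : (X.sub A).T := ⟨y, hy⟩
    refine ⟨ρ.f y', ?_⟩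
    rw [← map_smul, ← sub_eq_zero, ← map_sub, hf, map_sub, map_smul, ← hdy]
    exact (add_sub_cancel_right d ((p : ℤ_[p]) ^ k • y)).symm ▸ hd

variable [hX : Fact X.IsIntegral]

/-- `μ` is the largest slope of a subobject of `X[p]`, and `Y k` is the preimage in `T` of the
first step of the Harder-Narasimhan filtration of `X[p^k]`. -/
structure IsFirstSteps (μ : ℝ) (Y : ℕ → Submodule ℤ_[p] X.T) : Prop
    extends IsSlopeFiltration (p : ℤ_[p]) (X.slopeFun μ) (X.slopeConst μ) Y where
  isMaxSlope : X.IsMaxSlope μ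

theorem IsMaxSlope.exists_isFirstSteps {μ : ℝ} (hμ : X.IsMaxSlope μ) :
    ∃ Y : ℕ → Submodule ℤ_[p] X.T, IsFirstSteps μ Y :=
  hμ.isSlopeFunction.exists_isSlopeFiltration.imp fun _ hY => ⟨hY, hμ⟩

theorem slopeFun_map_subtype (μ : ℝ) {A : Submodule ℤ_[p] X.T} (hA : IsFull (p : ℤ_[p]) A)
    {B : Submodule ℤ_[p] (X.sub A).T} (hB : IsFull (p : ℤ_[p]) B) :
    X.slopeFun μ (B.map (X.subHom A).f) = (X.sub A).slopeFun μ B + X.slopeFun μ A := by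
  have hcoheight : coheight p (B.map (X.subHom A).f) = coheight p B + coheight p A :=
    coheight_map_subtype hA hB
  rw [slopeFun, slopeFun, slopeFun, codeg_map_subtype hA hB, hcoheight]
  ring

theorem slopeConst_sub (μ : ℝ) {A : Submodule ℤ_[p] X.T} (hA : IsFull (p : ℤ_[p]) A) :
    (X.sub A).slopeConst μ = X.slopeConst μ := by
  rw [slopeConst, slopeConst, rkT_sub hA, rkω_sub hA]

namespace IsFirstSteps

variable {μ : ℝ} {Y : ℕ → Submodule ℤ_[p] X.T} (h : IsFirstSteps μ Y)
include h

theorem smul_mem_succ_iff (k : ℕ) (t : X.T) : (p : ℤ_[p]) • t ∈ Y (k + 1) ↔ t ∈ Y k :=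
  IsSlopeFiltration.smul_mem_succ_iff h.isMaxSlope.isSlopeFunction h.toIsSlopeFiltration k

theorem isSaturated : IsSaturated (p : ℤ_[p]) (⨅ k, Y k) := isSaturated_iInf h.smul_mem_succ_iff

theorem exists_le_iInf_sup : ∃ m, ∀ k, Y (m + k) ≤ (⨅ k, Y k) ⊔ (p : ℤ_[p]) ^ k • Y m := by
  have := finite_quotient_prime_smul_top p X.T
  exact exists_filtration_le_iInf_sup
    (IsSlopeFiltration.succ_le h.isMaxSlope.isSlopeFunction h.toIsSlopeFiltration)
    h.smul_mem_succ_iff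

theorem isDescentStep {m : ℕ} (hm : ∀ k, Y (m + k) ≤ (⨅ k, Y k) ⊔ (p : ℤ_[p]) ^ k • Y m)
    (hZ : Z.IsIntegral) (ρ : Hom (X.sub (Y m)) Z) (hsurj : Function.Surjective ρ.f)
    (hf : ∀ t, ρ.f t = 0 ↔ (X.subHom (Y m)).f t ∈ ⨅ k, Y k)
    (hg : ∀ x, ρ.g x = 0 ↔ (X.subHom (Y m)).g x ∈ X.satImage (⨅ k, Y k)) :
    IsDescentStep X Z := by
  let P : Hom X (X.sub (Y m)) := powHom m (Y m) (h.pow_smul_top_le m) hX.out.span_eq_top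
  have hker : LinearMap.ker (ρ.comp P).f = ⨅ k, Y k := by
    ext t
    exact (hf (P.f t)).trans ⟨h.isSaturated.mem_of_pow_smul_mem, Submodule.smul_mem _ _⟩
  refine ⟨hZ, ρ.comp P, fun s => ?_, fun k hk => ?_, fun x => ?_⟩
  · obtain ⟨y, rfl⟩ := hsurj s
    exact ⟨m, (X.subHom (Y m)).f y, map_smul ρ.f _ y⟩
  · refine ⟨X.torsionSub k (Y k), h.isMaxSlope.isFirstStep h.toIsSlopeFiltration hk, fun t => ?_⟩
    refine (torsionHom_mem_torsionSub (h.pow_smul_top_le k)).trans ?_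
    refine (mem_filtration_iff h.smul_mem_succ_iff hm k).trans ?_
    exact (Hom.exists_f_eq_prime_pow_smul_iff (t := P.f t) hsurj hf k).symm
  · rw [hker, ← mem_saturation]
    exact (hg (P.g x)).trans
      ⟨(isSaturated_saturation _).mem_of_pow_smul_mem, Submodule.smul_mem _ _⟩

theorem isDescentStep_sub {m : ℕ}
    (hm : ∀ k, Y (m + k) ≤ (⨅ k, Y k) ⊔ (p : ℤ_[p]) ^ k • Y m) (hD : ⨅ k, Y k = ⊥) :
    IsDescentStep X (X.sub (Y m)) := by
  have hsat : X.satImage (⨅ k, Y k) = ⊥ := by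
    refine (Submodule.eq_bot_iff _).2 fun x hx => ?_
    obtain ⟨n, hn⟩ := mem_saturation.1 hx
    rw [hD, spanImage_bot, Submodule.mem_bot] at hn
    exact (smul_eq_zero.1 hn).resolve_left (pow_ne_zero n prime_cast_ne_zero)
  refine h.isDescentStep hm (sub_isIntegral (Y m)).out (Hom.id _) Function.surjective_id
    (fun t => ?_) (fun x => ?_)
  · rw [hD, Submodule.mem_bot]
    exact (Submodule.coe_eq_zero (x := (t : Y m))).symm
  · rw [hsat, Submodule.mem_bot]
    exact (Submodule.coe_eq_zero (x := (x : X.spanImage (Y m)))).symm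

theorem isDescentStep_satQuot {m : ℕ}
    (hm : ∀ k, Y (m + k) ≤ (⨅ k, Y k) ⊔ (p : ℤ_[p]) ^ k • Y m) :
    IsDescentStep X
      ((X.satQuot (⨅ k, Y k)).sub ((Y m).map (X.satQuotHom (⨅ k, Y k)).f)) := by
  have := Fact.mk (X.satQuot_isIntegral h.isSaturated)
  refine h.isDescentStep hm (sub_isIntegral _).out ((X.satQuotHom _).restrict (Y m))
    (Hom.restrict_f_surjective _ _) (fun t => ?_) (fun x => ?_)
  · rw [← X.satQuotHom_f_eq_zero]
    exact Subtype.ext_iff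
  · rw [← X.satQuotHom_g_eq_zero]
    exact Subtype.ext_iff

theorem maxSlope_sub_lt {m : ℕ} (hm : ∀ k, Y (m + k) ≤ (⨅ k, Y k) ⊔ (p : ℤ_[p]) ^ k • Y m)
    (hD : ⨅ k, Y k = ⊥) {ν : ℝ} (hν : (X.sub (Y m)).IsMaxSlope ν) : ν < μ := by
  by_contra! hμν
  obtain ⟨A, hA, hAν⟩ := hν.exists_eq
  have hAμ : (X.sub (Y m)).slopeFun μ A ≤ (X.sub (Y m)).slopeConst μ := by
    have hcoheight : coheight p A < (X.sub (Y m)).rkT := by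
      simpa using coheight_lt_of_prime_pow_smul_top_lt (k := 1) (by simpa using hA)
    simp only [slopeFun, slopeConst] at hAν ⊢
    nlinarith
  have hfun : X.slopeFun μ (A.map (X.subHom (Y m)).f) ≤ (m + 1 : ℕ) * X.slopeConst μ := by
    rw [slopeFun_map_subtype μ ⟨m, h.pow_smul_top_le m⟩ ⟨1, by simpa using hA.le⟩, h.apply_eq]
    rw [slopeConst_sub μ ⟨m, h.pow_smul_top_le m⟩] at hAμ
    push_cast
    linarith
  have hsmul : (p : ℤ_[p]) • Y m ≤ A.map (X.subHom (Y m)).f := by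
    have htop : (⊤ : Submodule ℤ_[p] (X.sub (Y m)).T).map (X.subHom (Y m)).f = Y m :=
      Submodule.map_subtype_top (Y m)
    simpa only [Submodule.map_pointwise_smul, htop] using
      Submodule.map_mono (f := (X.subHom (Y m)).f) hA.le
  have htop : (p : ℤ_[p]) ^ (m + 1) • ⊤ ≤ (p : ℤ_[p]) • Y m := by
    rw [pow_succ', mul_smul]
    exact smul_mono_right _ (h.pow_smul_top_le m)
  have hle : A.map (X.subHom (Y m)).f ≤ (p : ℤ_[p]) • Y m := by
    simpa only [hD, bot_sup_eq, pow_one] using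
      (h.le_of_apply_le (m + 1) _ (htop.trans hsmul) hfun).trans (hm 1)
  refine hA.not_ge fun a ha => ?_
  obtain ⟨y, hy, hya⟩ := hle (Submodule.mem_map_of_mem ha)
  exact ⟨⟨y, hy⟩, trivial, Subtype.ext hya⟩

end IsFirstSteps

end Step

end Triple

/-! ### The intersection of the first steps -/

namespace Triple

variable {p : ℕ} [hp : Fact p.Prime] {C : Type w} [NormedField C] [IsUltrametricDist C]
  [NormedAlgebra ℚ_[p] C] {X Z : Triple.{u, v, w} p C} [hX : Fact X.IsIntegral]

section FirstSteps

theorem codeg_sup_prime_pow_smul_top (D : Submodule ℤ_[p] X.T) (k : ℕ) :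
    X.codeg (D ⊔ (p : ℤ_[p]) ^ k • ⊤) = codegree p (X.spanImage D ⊔ (p : OC C) ^ k • ⊤) := by
  rw [codeg, spanImage_sup, spanImage_prime_pow_smul, hX.out.span_eq_top]

theorem le_codeg_sup_prime_pow_smul_top (D : Submodule ℤ_[p] X.T) (k : ℕ) :
    k * ((X.rkω : ℝ) - (X.sub D).rkω) ≤ X.codeg (D ⊔ (p : ℤ_[p]) ^ k • ⊤) :=
  codeg_sup_prime_pow_smul_top D k ▸ le_codegree_sup_prime_pow_smul_top (X.spanImage_fg D) k

theorem exists_codeg_sup_prime_pow_smul_top_le (D : Submodule ℤ_[p] X.T) : ∃ K : ℝ, ∀ k : ℕ,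
    X.codeg (D ⊔ (p : ℤ_[p]) ^ k • ⊤) ≤ k * ((X.rkω : ℝ) - (X.sub D).rkω) + K := by
  simp only [codeg_sup_prime_pow_smul_top]
  exact exists_codegree_sup_prime_pow_smul_top_le (X.spanImage_fg D)

theorem slopeFun_sup_prime_pow_smul_top_le {D : Submodule ℤ_[p] X.T}
    (hD : IsSaturated (p : ℤ_[p]) D) (μ : ℝ) (k : ℕ) :
    X.slopeFun μ (D ⊔ (p : ℤ_[p]) ^ k • ⊤) ≤
      k * X.slopeConst μ - k * (X.sub D).slopeConst μ := by
  have hcoheight : coheight p (D ⊔ (p : ℤ_[p]) ^ k • ⊤) = k * ((X.rkT : ℝ) - (X.sub D).rkT) :=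
    coheight_sup_prime_pow_smul_top hD k
  have hcodeg := le_codeg_sup_prime_pow_smul_top D k
  rw [slopeFun, slopeConst, slopeConst, hcoheight]
  linarith

theorem IsMaxSlope.slopeConst_sub_nonpos {μ : ℝ} (hμ : X.IsMaxSlope μ) {D : Submodule ℤ_[p] X.T}
    (hD : IsSaturated (p : ℤ_[p]) D) : (X.sub D).slopeConst μ ≤ 0 := by
  have hlow := hμ.le_slopeFun (D ⊔ (p : ℤ_[p]) ^ 1 • ⊤)
    ((congrArg (· • ⊤) (pow_one (p : ℤ_[p]))).ge.trans le_sup_right)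
  have hupp := slopeFun_sup_prime_pow_smul_top_le hD μ 1
  push_cast at hupp
  linarith

theorem Hom.codeg_sub_codeg_sup_le [Fact Z.IsIntegral] (φ : Hom X Z) {A B : Submodule ℤ_[p] X.T}
    {A' : Submodule ℤ_[p] Z.T} (hA : IsFull (p : ℤ_[p]) A) (hAB : A ≤ B)
    (hA' : IsFull (p : ℤ_[p]) A') (hφ : A.map φ.f ≤ A') :
    Z.codeg A' - Z.codeg (B.map φ.f ⊔ A') ≤ X.codeg A - X.codeg B := by
  have hmem : ∀ x ∈ X.spanImage B, φ.g x ∈ Z.spanImage (B.map φ.f ⊔ A') := fun x hx =>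
    Z.spanImage_mono le_sup_left (φ.map_spanImage B ▸ Submodule.mem_map_of_mem hx)
  have hle : (X.spanImage A).submoduleOf (X.spanImage B) ≤
      ((Z.spanImage A').submoduleOf (Z.spanImage (B.map φ.f ⊔ A'))).comap
        (φ.g.restrict hmem) := fun x hx =>
    Z.spanImage_mono hφ (φ.map_spanImage A ▸ Submodule.mem_map_of_mem hx)
  rw [X.codeg_eq_add hA hAB, Z.codeg_eq_add hA' le_sup_right, add_sub_cancel_left,
    add_sub_cancel_left]
  refine degree_le_of_surjective (f := Submodule.mapQ _ _ _ hle) ?_ (fittingIdeal_quotient_ne_bot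
    (X.isLattice_spanImage hA) (X.spanImage_fg B) (X.spanImage_mono hAB))
  rintro ⟨y, hy⟩
  have hy' := hy
  rw [spanImage_sup, ← φ.map_spanImage] at hy'
  obtain ⟨_, ⟨x, hx, rfl⟩, z, hz, rfl⟩ := Submodule.mem_sup.1 hy'
  refine ⟨Submodule.Quotient.mk ⟨x, hx⟩, (Submodule.Quotient.eq _).2 ?_⟩
  change φ.g x - (φ.g x + z) ∈ Z.spanImage A'
  simpa using hz

theorem IsMaxSlope.slopeConst_sub_le_slopeFun {μ : ℝ} (hμ : X.IsMaxSlope μ)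
    {D : Submodule ℤ_[p] X.T} (hD : IsSaturated (p : ℤ_[p]) D)
    {A : Submodule ℤ_[p] (X.sub D).T} (hA : (p : ℤ_[p]) • ⊤ ≤ A) :
    (X.sub D).slopeConst μ ≤ (X.sub D).slopeFun μ A := by
  have hcoheight : coheight p (A.map (X.subHom D).f ⊔ (p : ℤ_[p]) • ⊤) =
      coheight p A + ((X.rkT : ℝ) - (X.sub D).rkT) := coheight_map_subtype_sup hD hA
  have hlow := hμ.le_slopeFun (A.map (X.subHom D).f ⊔ (p : ℤ_[p]) • ⊤) le_sup_right
  have hcodeg := (X.subHom D).codeg_sub_codeg_sup_le isFull_top.smul hA isFull_top.smul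
    ((Submodule.map_pointwise_smul _ _ _).trans_le (smul_mono_right _ le_top))
  rw [codeg_prime_smul _ isFull_top, codeg_prime_smul _ isFull_top, codeg_top, codeg_top] at hcodeg
  simp only [slopeFun, slopeConst] at hlow ⊢
  rw [hcoheight] at hlow
  linarith

namespace IsFirstSteps

variable {μ : ℝ} {Y : ℕ → Submodule ℤ_[p] X.T} (h : IsFirstSteps μ Y)
include h

theorem le_iInf_of_slopeConst_nonneg {D : Submodule ℤ_[p] X.T} (hD : IsSaturated (p : ℤ_[p]) D)
    (hD' : 0 ≤ (X.sub D).slopeConst μ) : D ≤ ⨅ k, Y k := by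
  refine le_iInf fun k => le_sup_left.trans
    (h.le_of_apply_le k (D ⊔ (p : ℤ_[p]) ^ k • ⊤) le_sup_right ?_)
  have hupp := slopeFun_sup_prime_pow_smul_top_le hD μ k
  have hnonneg : 0 ≤ k * (X.sub D).slopeConst μ := by positivity
  linarith

theorem mul_neg_slopeConst_le {m : ℕ}
    (hm : ∀ k, Y (m + k) ≤ (⨅ k, Y k) ⊔ (p : ℤ_[p]) ^ k • Y m) {K : ℝ}
    (hK : ∀ k : ℕ, X.codeg ((⨅ k, Y k) ⊔ (p : ℤ_[p]) ^ k • ⊤) ≤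
      k * ((X.rkω : ℝ) - (X.sub (⨅ k, Y k)).rkω) + K) (k : ℕ) :
    k * -(X.sub (⨅ k, Y k)).slopeConst μ ≤ (1 - μ) * m * X.rkT + K := by
  have happly := h.apply_eq (m + k)
  have hcodeg := X.codeg_le ((isFull_pow_smul_top (m + k)).mono le_sup_right)
    (sup_le (iInf_le _ _) (h.pow_smul_top_le (m + k)) :
      (⨅ k, Y k) ⊔ (p : ℤ_[p]) ^ (m + k) • ⊤ ≤ Y (m + k))
  have hle : Y (m + k) ≤ (⨅ k, Y k) ⊔ (p : ℤ_[p]) ^ k • ⊤ :=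
    (hm k).trans (sup_le_sup_left (smul_mono_right _ le_top) _)
  have hcoheight : k * ((X.rkT : ℝ) - (X.sub (⨅ k, Y k)).rkT) ≤ coheight p (Y (m + k)) :=
    (coheight_sup_prime_pow_smul_top h.isSaturated k).ge.trans
      (coheight_le ⟨m + k, h.pow_smul_top_le (m + k)⟩ hle)
  have hmul := mul_le_mul_of_nonneg_left hcoheight (sub_nonneg.2 h.isMaxSlope.le_one)
  have hnonneg : (0 : ℝ) ≤ m * (X.sub (⨅ k, Y k)).rkω := by positivity
  have hKk := hK (m + k)
  simp only [slopeFun, slopeConst] at happly ⊢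
  push_cast at *
  linarith

theorem slopeConst_sub_iInf : (X.sub (⨅ k, Y k)).slopeConst μ = 0 := by
  refine le_antisymm (h.isMaxSlope.slopeConst_sub_nonpos h.isSaturated) ?_
  by_contra! hneg
  obtain ⟨m, hm⟩ := h.exists_le_iInf_sup
  obtain ⟨K, hK⟩ := exists_codeg_sup_prime_pow_smul_top_le (⨅ k, Y k)
  obtain ⟨k, hk⟩ := exists_lt_nsmul (neg_pos.2 hneg) ((1 - μ) * m * X.rkT + K)
  exact (h.mul_neg_slopeConst_le hm hK k).not_gt (by rwa [nsmul_eq_mul] at hk)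

end IsFirstSteps

end FirstSteps

end Triple

/-! ### Subquotients and Harder-Narasimhan chains -/

namespace Triple

variable {p : ℕ} [hp : Fact p.Prime] {C : Type w} [NormedField C] [IsUltrametricDist C]
  [NormedAlgebra ℚ_[p] C] {X Z : Triple.{u, v, w} p C}

section Semistable

theorem torsionHom_f_surjective (k : ℕ) : Function.Surjective (X.torsionHom k).f :=
  Submodule.mkQ_surjective _

theorem torsionHom_g_surjective (k : ℕ) : Function.Surjective (X.torsionHom k).g :=
  Submodule.mkQ_surjective _

theorem torsionSlope_sub_top (h : X.spanImage ⊤ = ⊤) : (X.sub ⊤).torsionSlope = X.torsionSlope := by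
  have hheight : (X.sub ⊤).torsionHeight = X.torsionHeight :=
    congrArg (fun n : ℕ => Real.logb p n)
      (Nat.card_congr (Submodule.topEquiv (R := ℤ_[p]) (M := X.T)).toEquiv)
  have hdegree : degree p C (X.sub ⊤).ω = degree p C X.ω :=
    degree_congr ((LinearEquiv.ofEq _ _ h).trans (Submodule.topEquiv (R := OC C) (M := X.ω)))
  rw [torsionSlope, torsionSlope, torsionDegree, torsionDegree, hheight, hdegree]

variable [hX : Fact X.IsIntegral]

theorem torsionSlope_torsion_one : (X.torsion 1).torsionSlope = X.slope := by
  have htop : X.torsionSub 1 ⊤ = ⊤ := by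
    rw [torsionSub, Submodule.map_top, LinearMap.range_eq_top.2 (torsionHom_f_surjective 1)]
  rw [← torsionSlope_sub_top ((X.torsionHom 1).spanImage_top_of_surjective
    (torsionHom_f_surjective 1) (torsionHom_g_surjective 1) hX.out.span_eq_top), ← htop,
    torsionSlope_torsionSub X le_top, coheight_top, codeg_top, slope]
  simp

theorem slopeConst_slope [Nontrivial X.T] : X.slopeConst X.slope = 0 := by
  have hpos : (0 : ℝ) < X.rkT := by exact_mod_cast Module.finrank_pos
  rw [slopeConst, slope]
  field_simp
  ring

theorem slope_eq_of_slopeConst_eq_zero [Nontrivial X.T] {μ : ℝ} (h : X.slopeConst μ = 0) :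
    X.slope = μ := by
  have hpos : (0 : ℝ) < X.rkT := by exact_mod_cast Module.finrank_pos
  rw [slopeConst] at h
  rw [slope, div_eq_iff hpos.ne']
  linarith

theorem torsionSlope_torsionSub_le_slope_iff [Nontrivial X.T] {A : Submodule ℤ_[p] X.T}
    (hA : (p : ℤ_[p]) ^ 1 • ⊤ < A) :
    ((X.torsion 1).sub (X.torsionSub 1 A)).torsionSlope ≤ X.slope ↔
      0 ≤ X.slopeFun X.slope A := by
  rw [torsionSlope_torsionSub_eq X.slope hA, slopeConst_slope, mul_zero, zero_sub,
    add_le_iff_nonpos_right, neg_div, neg_nonpos,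
    le_div_iff₀ (sub_pos.2 (coheight_lt_of_prime_pow_smul_top_lt hA)), zero_mul]

theorem slopeFun_slope_prime_pow_smul_top [Nontrivial X.T] (k : ℕ) :
    X.slopeFun X.slope ((p : ℤ_[p]) ^ k • ⊤) = 0 := by
  have hconst := congrArg (fun c : ℝ => k * c) (slopeConst_slope (X := X))
  simp only [slopeConst] at hconst
  rw [slopeFun, X.coheight_prime_pow_smul_top, codeg_prime_pow_smul_top]
  linarith

theorem semistable_iff : X.Semistable ↔ Nontrivial X.T ∧
    ∀ A : Submodule ℤ_[p] X.T, (p : ℤ_[p]) ^ 1 • ⊤ ≤ A → 0 ≤ X.slopeFun X.slope A := by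
  constructor
  · rintro ⟨hnontrivial, h⟩
    have := (torsionHom_f_surjective (X := X) 1).nontrivial
    refine ⟨this, fun A hA => ?_⟩
    obtain rfl | hA := hA.eq_or_lt
    · exact (slopeFun_slope_prime_pow_smul_top 1).ge
    · rw [torsionSlope_torsion_one] at h
      exact (torsionSlope_torsionSub_le_slope_iff hA).1
        (h _ fun hbot => hA.not_ge (torsionSub_eq_bot_iff.1 hbot))
  · rintro ⟨hnontrivial, h⟩
    refine ⟨?_, fun N hN => ?_⟩
    · obtain ⟨t, -, ht⟩ := SetLike.exists_of_lt (prime_smul_top_lt (X := X))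
      exact ⟨(X.torsionHom 1).f t, 0, fun h0 => ht (by simpa using torsionHom_eq_zero_iff.1 h0)⟩
    · obtain ⟨A, hA, rfl⟩ := exists_eq_torsionSub 1 N
      rw [torsionSlope_torsion_one, torsionSlope_torsionSub_le_slope_iff
        (hA.lt_of_ne fun heq => hN (torsionSub_eq_bot_iff.2 heq.ge))]
      exact h A hA

namespace IsFirstSteps

variable {μ : ℝ} {Y : ℕ → Submodule ℤ_[p] X.T} (h : IsFirstSteps μ Y) (hD : ⨅ k, Y k ≠ ⊥)
include h hD

theorem slope_sub_iInf : (X.sub (⨅ k, Y k)).slope = μ := by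
  have : Nontrivial (X.sub (⨅ k, Y k)).T := Submodule.nontrivial_iff_ne_bot.2 hD
  exact slope_eq_of_slopeConst_eq_zero h.slopeConst_sub_iInf

theorem semistable_sub_iInf : (X.sub (⨅ k, Y k)).Semistable := by
  refine semistable_iff.2 ⟨Submodule.nontrivial_iff_ne_bot.2 hD, fun A hA => ?_⟩
  rw [h.slope_sub_iInf hD, ← h.slopeConst_sub_iInf]
  exact h.isMaxSlope.slopeConst_sub_le_slopeFun h.isSaturated (by simpa using hA)

end IsFirstSteps

end Semistable

section Iso

/-- An isomorphism of triples. -/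
def Hom.IsIso (φ : Hom X Z) : Prop := Function.Bijective φ.f ∧ Function.Bijective φ.g

namespace Hom.IsIso

variable {φ : Hom X Z} (hφ : φ.IsIso)
include hφ

theorem exists_symm : ∃ ψ : Hom Z X, ψ.IsIso := by
  let e := LinearEquiv.ofBijective φ.f hφ.1
  let e' := LinearEquiv.ofBijective φ.g hφ.2
  refine ⟨⟨e.symm.toLinearMap, e'.symm.toLinearMap, fun t => ?_⟩,
    e.symm.bijective, e'.symm.bijective⟩
  obtain ⟨t, rfl⟩ := e.surjective t
  have hcomm : Z.α (e t) = e' (X.α t) := (φ.comm t).symm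
  simp [hcomm]

theorem isIntegral (hX : X.IsIntegral) : Z.IsIntegral := by
  let e := LinearEquiv.ofBijective φ.f hφ.1
  let e' := LinearEquiv.ofBijective φ.g hφ.2
  have := hX.free_T
  have := hX.finite_T
  have := hX.free_ω
  have := hX.finite_ω
  exact ⟨Module.Free.of_equiv e, Module.Finite.equiv e, Module.Free.of_equiv e',
    Module.Finite.equiv e', φ.spanImage_top_of_surjective hφ.1.2 hφ.2.2 hX.span_eq_top⟩

theorem slope_eq : Z.slope = X.slope := by
  rw [slope, slope, (LinearEquiv.ofBijective φ.f hφ.1).finrank_eq,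
    (LinearEquiv.ofBijective φ.g hφ.2).finrank_eq]

theorem slopeFun_map (μ : ℝ) (A : Submodule ℤ_[p] X.T) :
    Z.slopeFun μ (A.map φ.f) = X.slopeFun μ A := by
  have hcoheight : coheight p (A.map φ.f) = coheight p A := by
    rw [← coheight_comap_of_surjective hφ.1.2, Submodule.comap_map_eq_of_injective hφ.1.1]
  have hcodeg : Z.codeg (A.map φ.f) = X.codeg A := by
    rw [codeg, codeg, ← φ.map_spanImage]
    exact (degree_congr (Submodule.Quotient.equiv _ _
      (LinearEquiv.ofBijective φ.g hφ.2) rfl)).symm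
  rw [slopeFun, slopeFun, hcoheight, hcodeg]

theorem semistable [Fact X.IsIntegral] (h : X.Semistable) : Z.Semistable := by
  have := Fact.mk (hφ.isIntegral (Fact.out : X.IsIntegral))
  obtain ⟨hnontrivial, h⟩ := semistable_iff.1 h
  refine semistable_iff.2 ⟨hφ.1.1.nontrivial, fun A hA => ?_⟩
  rw [hφ.slope_eq, ← Submodule.map_comap_eq_of_surjective hφ.1.2 A, hφ.slopeFun_map]
  refine h _ (Submodule.map_le_iff_le_comap.1 ?_)
  rwa [Submodule.map_pointwise_smul, Submodule.map_top, LinearMap.range_eq_top.2 hφ.1.2]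

end Hom.IsIso

theorem map_submoduleOf {A B : Submodule ℤ_[p] X.T} (h : A ≤ B) :
    (A.submoduleOf B).map (X.subHom B).f = A :=
  Submodule.map_comap_eq_of_le (h.trans (Submodule.range_subtype B).ge)

theorem mem_spanImage_submoduleOf {A B : Submodule ℤ_[p] X.T} (h : A ≤ B)
    {x : (X.sub B).ω} : x ∈ (X.sub B).spanImage (A.submoduleOf B) ↔
      (X.subHom B).g x ∈ X.spanImage A := by
  have heq := submoduleOf_spanImage_map_subtype B (A.submoduleOf B)
  rw [map_submoduleOf h] at heq
  rw [← heq]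
  rfl

/-- The projection from the subobject attached to `B` to its quotient by the one attached to `A`. -/
def subquotHom (A B : Submodule ℤ_[p] X.T) : Hom (X.sub B) (X.subquot A B) := quotHom _ _ _ _

theorem subquotHom_f_surjective (A B : Submodule ℤ_[p] X.T) :
    Function.Surjective (subquotHom A B).f := Submodule.mkQ_surjective _

theorem subquotHom_g_surjective (A B : Submodule ℤ_[p] X.T) :
    Function.Surjective (subquotHom A B).g := Submodule.mkQ_surjective _

theorem subquotHom_f_eq_zero {A B : Submodule ℤ_[p] X.T} {t : (X.sub B).T} :
    (subquotHom A B).f t = 0 ↔ (X.subHom B).f t ∈ A :=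
  Submodule.Quotient.mk_eq_zero (A.submoduleOf B)

theorem subquotHom_g_eq_zero {A B : Submodule ℤ_[p] X.T} (h : A ≤ B) {x : (X.sub B).ω} :
    (subquotHom A B).g x = 0 ↔ (X.subHom B).g x ∈ X.spanImage A :=
  (Submodule.Quotient.mk_eq_zero _).trans (mem_spanImage_submoduleOf h)

/-- The morphism induced on subquotients. -/
def Hom.subquot (φ : Hom X Z) {A B : Submodule ℤ_[p] X.T} (h : A ≤ B) :
    Hom (X.subquot A B) (Z.subquot (A.map φ.f) (B.map φ.f)) where
  f := Submodule.mapQ _ _ (φ.restrict B).f fun t ht => by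
    change φ.f ((X.subHom B).f t) ∈ A.map φ.f
    exact Submodule.mem_map_of_mem ht
  g := Submodule.mapQ _ _ (φ.restrict B).g fun x hx => by
    rw [Submodule.mem_comap, mem_spanImage_submoduleOf (Submodule.map_mono h)]
    rw [mem_spanImage_submoduleOf h] at hx
    exact φ.map_spanImage A ▸ Submodule.mem_map_of_mem (f := φ.g) hx
  comm t := by
    obtain ⟨t, rfl⟩ := Submodule.mkQ_surjective _ t
    exact congrArg (Submodule.mkQ _) ((φ.restrict B).comm t)

theorem Hom.subquot_isIso (φ : Hom X Z) {A B : Submodule ℤ_[p] X.T} (h : A ≤ B)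
    (hf : ∀ t ∈ B, φ.f t ∈ A.map φ.f → t ∈ A)
    (hg : ∀ x ∈ X.spanImage B, φ.g x ∈ Z.spanImage (A.map φ.f) → x ∈ X.spanImage A) :
    (φ.subquot h).IsIso := by
  refine ⟨⟨(injective_iff_map_eq_zero _).2 fun t ht => ?_, fun s => ?_⟩,
    ⟨(injective_iff_map_eq_zero _).2 fun x hx => ?_, fun y => ?_⟩⟩
  · obtain ⟨t, rfl⟩ := subquotHom_f_surjective A B t
    exact subquotHom_f_eq_zero.2 (hf _ t.2 (subquotHom_f_eq_zero.1 ht))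
  · obtain ⟨s, rfl⟩ := subquotHom_f_surjective _ _ s
    obtain ⟨t, rfl⟩ := φ.restrict_f_surjective B s
    exact ⟨(subquotHom A B).f t, rfl⟩
  · obtain ⟨x, rfl⟩ := subquotHom_g_surjective A B x
    exact (subquotHom_g_eq_zero h).2
      (hg _ x.2 ((subquotHom_g_eq_zero (Submodule.map_mono h)).1 hx))
  · obtain ⟨y, rfl⟩ := subquotHom_g_surjective _ _ y
    obtain ⟨x, rfl⟩ := φ.restrict_g_surjective B y
    exact ⟨(subquotHom A B).g x, rfl⟩

theorem Hom.subquot_isIso_of_injective (φ : Hom X Z) {A B : Submodule ℤ_[p] X.T} (h : A ≤ B)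
    (hf : Function.Injective φ.f) (hg : Function.Injective φ.g) : (φ.subquot h).IsIso := by
  refine φ.subquot_isIso h ?_ fun x _ hx => ?_
  · rintro t - ⟨a, ha, hat⟩
    exact hf hat ▸ ha
  · rw [← φ.map_spanImage] at hx
    obtain ⟨a, ha, hax⟩ := hx
    exact hg hax ▸ ha

theorem subquotHom_bot_isIso (B : Submodule ℤ_[p] X.T) : (subquotHom ⊥ B).IsIso := by
  refine ⟨⟨(injective_iff_map_eq_zero _).2 fun t ht => ?_, subquotHom_f_surjective _ _⟩,
    ⟨(injective_iff_map_eq_zero _).2 fun x hx => ?_, subquotHom_g_surjective _ _⟩⟩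
  · exact Subtype.ext ((Submodule.mem_bot ℤ_[p]).1 (subquotHom_f_eq_zero.1 ht))
  · have hbot := (subquotHom_g_eq_zero bot_le).1 hx
    rw [spanImage_bot, Submodule.mem_bot] at hbot
    exact Subtype.ext hbot

end Iso

section Chain

/-- `F` is a chain `A = F_0 ⊊ ... ⊊ F_r = B` whose graded pieces are semi-stable integral
Hodge-Tate modules with strictly decreasing slopes. -/
structure IsHNChain (X : Triple.{u, v, w} p C) {r : ℕ} (F : Fin (r + 1) → Submodule ℤ_[p] X.T)
    (A B : Submodule ℤ_[p] X.T) : Prop where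
  zero : F 0 = A
  last : F (Fin.last r) = B
  strictMono : StrictMono F
  isIntegral : ∀ i : Fin r, (X.subquot (F i.castSucc) (F i.succ)).IsIntegral
  semistable : ∀ i : Fin r, (X.subquot (F i.castSucc) (F i.succ)).Semistable
  strictAnti : StrictAnti fun i : Fin r => (X.subquot (F i.castSucc) (F i.succ)).slope

namespace IsHNChain

variable {r : ℕ} {F : Fin (r + 1) → Submodule ℤ_[p] X.T} {A B : Submodule ℤ_[p] X.T}

theorem isHNType (h : X.IsHNChain F ⊥ ⊤) : X.IsHNType :=
  ⟨r, F, h.zero, h.last, h.strictMono, fun i => ⟨h.isIntegral i, h.semistable i⟩, h.strictAnti⟩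

theorem ge (h : X.IsHNChain F A B) (i : Fin (r + 1)) : A ≤ F i :=
  h.zero ▸ h.strictMono.monotone (Fin.zero_le i)

theorem le (h : X.IsHNChain F A B) (i : Fin (r + 1)) : F i ≤ B :=
  h.last ▸ h.strictMono.monotone (Fin.le_last i)

theorem le_succ (h : X.IsHNChain F A B) (i : Fin r) : F i.castSucc ≤ F i.succ :=
  h.strictMono.monotone (Fin.castSucc_lt_succ).le

theorem of_isIso (h : X.IsHNChain F A B) {F' : Fin (r + 1) → Submodule ℤ_[p] Z.T}
    (hmono : StrictMono F') (hiso : ∀ i : Fin r, ∃ φ : Hom (X.subquot (F i.castSucc) (F i.succ))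
      (Z.subquot (F' i.castSucc) (F' i.succ)), φ.IsIso) :
    Z.IsHNChain F' (F' 0) (F' (Fin.last r)) := by
  choose φ hφ using hiso
  refine ⟨rfl, rfl, hmono, fun i => (hφ i).isIntegral (h.isIntegral i), fun i => ?_, ?_⟩
  · have := Fact.mk (h.isIntegral i)
    exact (hφ i).semistable (h.semistable i)
  · intro i j hij
    simp only [(hφ _).slope_eq]
    exact h.strictAnti hij

theorem map (h : X.IsHNChain F A B) (φ : Hom X Z) (hf : Function.Injective φ.f)
    (hg : Function.Injective φ.g) :
    Z.IsHNChain (fun i => (F i).map φ.f) (A.map φ.f) (B.map φ.f) := by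
  have hmap := h.of_isIso ((Submodule.map_strictMono_of_injective hf).comp h.strictMono)
    fun i => ⟨_, φ.subquot_isIso_of_injective (h.le_succ i) hf hg⟩
  rwa [Function.comp_apply, Function.comp_apply, h.zero, h.last] at hmap

theorem isHNType_sub (h : X.IsHNChain F ⊥ B) : (X.sub B).IsHNType := by
  have hmap (i) : ((F i).submoduleOf B).map (X.subHom B).f = F i := map_submoduleOf (h.le i)
  have hmono : StrictMono fun i => (F i).submoduleOf B := fun i j hij =>
    (Submodule.comap_mono (h.strictMono hij).le).lt_of_ne fun heq => (h.strictMono hij).ne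
      ((hmap i).symm.trans ((congrArg (Submodule.map (X.subHom B).f) heq).trans (hmap j)))
  have hzero : (F 0).submoduleOf B = ⊥ := by
    rw [h.zero]
    exact (Submodule.comap_bot _).trans (Submodule.ker_subtype _)
  have hlast : (F (Fin.last r)).submoduleOf B = ⊤ := by
    rw [h.last, Submodule.submoduleOf_self]
  have hchain : (X.sub B).IsHNChain (fun i => (F i).submoduleOf B) _ _ :=
    h.of_isIso hmono fun i => by
      have hiso := ((X.subHom B).subquot_isIso_of_injective
        (A := (F i.castSucc).submoduleOf B) (B := (F i.succ).submoduleOf B)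
        (hmono.monotone (Fin.castSucc_lt_succ).le)
        Subtype.val_injective Subtype.val_injective).exists_symm
      rwa [hmap, hmap] at hiso
  exact isHNType (hzero ▸ hlast ▸ hchain)

theorem exists_slope_le (h : X.IsHNChain F ⊥ B) (i : Fin r) :
    ∃ E : Submodule ℤ_[p] X.T, E ≠ ⊥ ∧
      (X.subquot (F i.castSucc) (F i.succ)).slope ≤ (X.sub E).slope := by
  cases r with
  | zero => exact i.elim0
  | succ r =>
    have hzero : F (Fin.castSucc (0 : Fin (r + 1))) = ⊥ := h.zero
    refine ⟨F (Fin.succ 0), ?_, ?_⟩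
    · rw [← bot_lt_iff_ne_bot, ← hzero]
      exact h.strictMono Fin.castSucc_lt_succ
    · have hle := h.strictAnti.antitone (Fin.zero_le i)
      simp only [hzero] at hle
      rwa [← (subquotHom_bot_isIso _).slope_eq]

theorem cons [Fact X.IsIntegral] (h : X.IsHNChain F A B) (hA : A ≠ ⊥)
    (hss : (X.sub A).Semistable)
    (hslope : ∀ i : Fin r, (X.subquot (F i.castSucc) (F i.succ)).slope < (X.sub A).slope) :
    X.IsHNChain (Fin.cons ⊥ F : Fin (r + 2) → Submodule ℤ_[p] X.T) ⊥ B := by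
  obtain rfl := h.zero
  have hfirst := subquotHom_bot_isIso (F 0)
  refine ⟨rfl, h.last, Fin.strictMono_cons.2 ⟨?_, h.strictMono⟩, fun i => ?_, fun i => ?_,
    fun i j hij => ?_⟩
  · exact fun i => (bot_lt_iff_ne_bot.2 hA).trans_le (h.ge i)
  · cases i using Fin.cases with
    | zero => exact hfirst.isIntegral (sub_isIntegral _).out
    | succ i => exact h.isIntegral i
  · cases i using Fin.cases with
    | zero => exact hfirst.semistable hss
    | succ i => exact h.semistable i
  · cases j using Fin.cases with
    | zero => exact absurd hij (Fin.not_lt_zero i)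
    | succ j =>
      cases i using Fin.cases with
      | zero => exact (hslope j).trans_eq hfirst.slope_eq.symm
      | succ i => exact h.strictAnti (Fin.succ_lt_succ_iff.1 hij)

end IsHNChain

end Chain

end Triple

/-! ### Existence of Harder-Narasimhan chains and termination -/

theorem finrank_range_add_finrank_ker {R M N : Type*} [CommRing R] [IsDomain R] [AddCommGroup M]
    [AddCommGroup N] [Module R M] [Module R N] [Module.Finite R M] (f : M →ₗ[R] N) :
    Module.finrank R (LinearMap.range f) + Module.finrank R (LinearMap.ker f) =
      Module.finrank R M := by
  rw [← f.quotKerEquivRange.finrank_eq, Submodule.finrank_quotient_add_finrank]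

namespace Triple

variable {p : ℕ} [hp : Fact p.Prime] {C : Type w} [NormedField C] [IsUltrametricDist C]
  [NormedAlgebra ℚ_[p] C] {X : Triple.{u, v, w} p C}

section SatQuotSlope

theorem le_comap_satQuotHom (D : Submodule ℤ_[p] X.T) (E : Submodule ℤ_[p] (X.satQuot D).T) :
    D ≤ E.comap (X.satQuotHom D).f := fun t ht => by
  rw [Submodule.mem_comap, X.satQuotHom_f_eq_zero.2 ht]
  exact Submodule.zero_mem _

variable [hX : Fact X.IsIntegral]

theorem finrank_comap_satQuotHom (D : Submodule ℤ_[p] X.T)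
    (E : Submodule ℤ_[p] (X.satQuot D).T) :
    Module.finrank ℤ_[p] (E.comap (X.satQuotHom D).f) =
      ((X.satQuot D).sub E).rkT + (X.sub D).rkT := by
  have hrank := finrank_range_add_finrank_ker
    ((X.satQuotHom D).f.domRestrict (E.comap (X.satQuotHom D).f))
  have hker : LinearMap.ker ((X.satQuotHom D).f.domRestrict (E.comap (X.satQuotHom D).f)) =
      D.submoduleOf (E.comap (X.satQuotHom D).f) := by
    ext t
    exact X.satQuotHom_f_eq_zero
  rw [LinearMap.range_domRestrict,
    Submodule.map_comap_eq_of_surjective (X.satQuotHom_f_surjective D), hker,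
    (Submodule.submoduleOfEquivOfLe (le_comap_satQuotHom D E)).finrank_eq] at hrank
  exact hrank.symm

theorem finrank_spanImage_comap_le (D : Submodule ℤ_[p] X.T)
    (E : Submodule ℤ_[p] (X.satQuot D).T) :
    Module.finrank (OC C) (X.spanImage (E.comap (X.satQuotHom D).f)) ≤
      ((X.satQuot D).sub E).rkω + (X.sub D).rkω := by
  let W := X.spanImage (E.comap (X.satQuotHom D).f)
  have := Module.Finite.iff_fg.2 (X.spanImage_fg (E.comap (X.satQuotHom D).f))
  have : Module.Finite (OC C) (X.satImage D) :=
    Module.Finite.iff_fg.2 (saturation_fg (p := p) (X.spanImage D))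
  have hrank := finrank_range_add_finrank_ker ((X.satQuotHom D).g.domRestrict W)
  rw [LinearMap.range_domRestrict, Hom.map_spanImage,
    Submodule.map_comap_eq_of_surjective (X.satQuotHom_f_surjective D)] at hrank
  have hker : Module.finrank (OC C) (LinearMap.ker ((X.satQuotHom D).g.domRestrict W)) ≤
      Module.finrank (OC C) (X.satImage D) := by
    let f := W.subtype.restrict (p := LinearMap.ker ((X.satQuotHom D).g.domRestrict W))
      (q := X.satImage D) fun x hx => X.satQuotHom_g_eq_zero.1 hx
    refine LinearMap.finrank_le_finrank_of_injective (f := f) fun x y hxy => ?_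
    exact Subtype.ext (Subtype.ext (congrArg (Subtype.val : X.satImage D → X.ω) hxy))
  exact hrank.ge.trans (Nat.add_le_add_left
    (hker.trans_eq (finrank_saturation (X.spanImage_fg D))) _)

theorem rkω_sub_saturation_le (E : Submodule ℤ_[p] X.T) :
    (X.sub (saturation (p : ℤ_[p]) E)).rkω ≤ Module.finrank (OC C) (X.spanImage E) := by
  obtain ⟨k, hk⟩ := exists_pow_smul_mem_of_fg
    (IsNoetherian.noetherian (saturation (p : ℤ_[p]) E))
  have := Module.Finite.iff_fg.2 (X.spanImage_fg E)
  refine finrank_le_of_pow_smul_mem (N := X.spanImage (saturation (p : ℤ_[p]) E))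
    (prime_cast_ne_zero (p := p) (C := C)) k fun x hx => ?_
  refine X.spanImage_mono (A := (p : ℤ_[p]) ^ k • saturation (p : ℤ_[p]) E) ?_ ?_
  · rintro _ ⟨t, ht, rfl⟩
    exact hk t ht
  · rw [spanImage_prime_pow_smul]
    exact Submodule.smul_mem_pointwise_smul _ _ _ hx

theorem IsFirstSteps.slope_satQuot_sub_lt {μ : ℝ} {Y : ℕ → Submodule ℤ_[p] X.T}
    (h : IsFirstSteps μ Y) {E : Submodule ℤ_[p] (X.satQuot (⨅ k, Y k)).T} (hE : E ≠ ⊥) :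
    ((X.satQuot (⨅ k, Y k)).sub E).slope < μ := by
  have := Fact.mk (X.satQuot_isIntegral h.isSaturated)
  have : Nontrivial ((X.satQuot (⨅ k, Y k)).sub E).T := Submodule.nontrivial_iff_ne_bot.2 hE
  have hpos : (0 : ℝ) < ((X.satQuot (⨅ k, Y k)).sub E).rkT := by exact_mod_cast Module.finrank_pos
  by_contra! hle
  rw [slope, le_div_iff₀ hpos] at hle
  let E' := saturation (p : ℤ_[p]) (E.comap (X.satQuotHom (⨅ k, Y k)).f)
  have hrkT : (((X.satQuot (⨅ k, Y k)).sub E).rkT + (X.sub (⨅ k, Y k)).rkT : ℝ) ≤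
      (X.sub E').rkT := by
    exact_mod_cast (finrank_comap_satQuotHom _ E).ge.trans
      (Submodule.finrank_mono (le_saturation _))
  have hrkω : ((X.sub E').rkω : ℝ) ≤
      ((X.satQuot (⨅ k, Y k)).sub E).rkω + (X.sub (⨅ k, Y k)).rkω := by
    exact_mod_cast (rkω_sub_saturation_le _).trans (finrank_spanImage_comap_le _ E)
  have hconst : 0 ≤ (X.sub E').slopeConst μ := by
    have hzero := h.slopeConst_sub_iInf
    have hmul := mul_le_mul_of_nonneg_left hrkT (sub_nonneg.2 h.isMaxSlope.le_one)
    simp only [slopeConst] at hzero ⊢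
    linarith
  refine hE ((Submodule.eq_bot_iff _).2 fun s hs => ?_)
  obtain ⟨t, rfl⟩ := X.satQuotHom_f_surjective _ s
  exact X.satQuotHom_f_eq_zero.2
    (h.le_iInf_of_slopeConst_nonneg (isSaturated_saturation _) hconst (le_saturation _ hs))

end SatQuotSlope

section FullHNChain

/-- Multiplication by `p^k`. -/
def smulHom (X : Triple.{u, v, w} p C) (k : ℕ) : Hom X X where
  f := LinearMap.lsmul ℤ_[p] X.T ((p : ℤ_[p]) ^ k)
  g := LinearMap.lsmul (OC C) X.ω ((p : OC C) ^ k)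
  comm t := (X.α_prime_pow_smul k t).symm

/-- Some submodule of finite index in `T` carries a Harder-Narasimhan chain; equivalently, `X` is
isogenous to a module of HN type. -/
def HasFullHNChain (X : Triple.{u, v, w} p C) : Prop :=
  ∃ B, IsFull (p : ℤ_[p]) B ∧ ∃ (r : ℕ) (F : Fin (r + 1) → Submodule ℤ_[p] X.T), X.IsHNChain F ⊥ B

theorem hasFullHNChain_of_subsingleton [Subsingleton X.T] : X.HasFullHNChain :=
  ⟨⊤, isFull_top, 0, fun _ => ⊤, Subsingleton.elim _ _, rfl,
    fun i j hij => (hij.ne ((Fin.eq_zero i).trans (Fin.eq_zero j).symm)).elim,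
    fun i => i.elim0, fun i => i.elim0, fun i => i.elim0⟩

theorem HasFullHNChain.of_sub {A : Submodule ℤ_[p] X.T} (hA : IsFull (p : ℤ_[p]) A)
    (h : (X.sub A).HasFullHNChain) : X.HasFullHNChain := by
  obtain ⟨B, hB, r, F, hF⟩ := h
  have hmap := hF.map (X.subHom A) Subtype.val_injective Subtype.val_injective
  rw [Submodule.map_bot] at hmap
  exact ⟨_, hA.map_subtype hB, r, _, hmap⟩

variable [hX : Fact X.IsIntegral]

theorem isogenous_sub {B : Submodule ℤ_[p] X.T} (hB : IsFull (p : ℤ_[p]) B) :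
    X.Isogenous (X.sub B) := by
  obtain ⟨k, hk⟩ := hB
  exact ⟨k, powHom k B hk hX.out.span_eq_top, X.subHom B, fun _ => rfl, fun _ => rfl,
    fun _ => rfl, fun _ => rfl⟩

theorem HasFullHNChain.exists_isogenous (h : X.HasFullHNChain) :
    ∃ Y : Triple.{u, v, w} p C, Y.IsIntegral ∧ X.Isogenous Y ∧ Y.IsHNType := by
  obtain ⟨B, hB, r, F, hF⟩ := h
  exact ⟨X.sub B, (sub_isIntegral B).out, isogenous_sub hB, hF.isHNType_sub⟩

omit hX in
theorem mem_spanImage_of_mem_satImage {D : Submodule ℤ_[p] X.T} {k : ℕ}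
    (hk : ∀ x ∈ X.satImage D, (p : OC C) ^ k • x ∈ X.spanImage D) {x : X.ω}
    (hx : x ∈ X.satImage D) (hx' : x ∈ X.spanImage (D ⊔ (p : ℤ_[p]) ^ k • ⊤)) :
    x ∈ X.spanImage D := by
  rw [spanImage_sup, spanImage_prime_pow_smul] at hx'
  obtain ⟨u, hu, _, ⟨v, -, rfl⟩, rfl⟩ := Submodule.mem_sup.1 hx'
  refine Submodule.add_mem _ hu (hk v ?_)
  have hv := (X.satImage D).sub_mem hx (X.spanImage_le_satImage D hu)
  rw [add_sub_cancel_left] at hv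
  exact (isSaturated_saturation _).mem_of_pow_smul_mem hv

omit hX in
theorem comap_satQuotHom_le_sup {D : Submodule ℤ_[p] X.T} {k : ℕ}
    {E : Submodule ℤ_[p] (X.satQuot D).T} (hE : E ≤ (p : ℤ_[p]) ^ k • ⊤) :
    E.comap (X.satQuotHom D).f ≤ D ⊔ (p : ℤ_[p]) ^ k • ⊤ := by
  intro t ht
  obtain ⟨s, -, hs⟩ := hE ht
  obtain ⟨y, rfl⟩ := X.satQuotHom_f_surjective D s
  refine Submodule.mem_sup.2 ⟨t - (p : ℤ_[p]) ^ k • y, X.satQuotHom_f_eq_zero.1 ?_, _,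
    Submodule.smul_mem_pointwise_smul y _ _ trivial, sub_add_cancel _ _⟩
  rw [map_sub, map_smul, sub_eq_zero]
  exact hs.symm

omit hX in
theorem exists_isIso_subquot_comap_satQuotHom {D : Submodule ℤ_[p] X.T} {k : ℕ}
    (hk : ∀ x ∈ X.satImage D, (p : OC C) ^ k • x ∈ X.spanImage D)
    {P Q : Submodule ℤ_[p] (X.satQuot D).T} (hPQ : P ≤ Q) (hQ : Q ≤ (p : ℤ_[p]) ^ k • ⊤) :
    ∃ φ : Hom ((X.satQuot D).subquot P Q)
      (X.subquot (P.comap (X.satQuotHom D).f) (Q.comap (X.satQuotHom D).f)), φ.IsIso := by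
  have hmap (E : Submodule ℤ_[p] (X.satQuot D).T) :
      (E.comap (X.satQuotHom D).f).map (X.satQuotHom D).f = E :=
    Submodule.map_comap_eq_of_surjective (X.satQuotHom_f_surjective D) E
  have hiso : ((X.satQuotHom D).subquot (A := P.comap (X.satQuotHom D).f)
      (B := Q.comap (X.satQuotHom D).f) (Submodule.comap_mono hPQ)).IsIso := by
    refine Hom.subquot_isIso _ _ (fun t _ ht => ?_) fun x hx hx' => ?_
    · rwa [hmap] at ht
    · rw [← Hom.map_spanImage] at hx'
      obtain ⟨y, hy, hyx⟩ := hx'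
      have hxy : x - y ∈ X.satImage D := by
        rw [← X.satQuotHom_g_eq_zero, map_sub, sub_eq_zero]
        exact hyx.symm
      have hD := mem_spanImage_of_mem_satImage hk hxy ((X.spanImage _).sub_mem
        (X.spanImage_mono (comap_satQuotHom_le_sup hQ) hx)
        (X.spanImage_mono (comap_satQuotHom_le_sup (hPQ.trans hQ)) hy))
      simpa using Submodule.add_mem _ (X.spanImage_mono (le_comap_satQuotHom D P) hD) hy
  have hsymm := hiso.exists_symm
  rwa [hmap, hmap] at hsymm

theorem HasFullHNChain.of_satQuot {D : Submodule ℤ_[p] X.T} (hD : IsSaturated (p : ℤ_[p]) D)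
    (hbot : D ≠ ⊥) (hss : (X.sub D).Semistable)
    (hslope : ∀ E : Submodule ℤ_[p] (X.satQuot D).T, E ≠ ⊥ →
      ((X.satQuot D).sub E).slope < (X.sub D).slope)
    (h : (X.satQuot D).HasFullHNChain) : X.HasFullHNChain := by
  obtain ⟨B, hB, r, F, hF⟩ := h
  have := Fact.mk (X.satQuot_isIntegral hD)
  obtain ⟨k, hk⟩ := exists_pow_smul_mem_of_fg (saturation_fg (p := p) (X.spanImage D))
  have hpF : (X.satQuot D).IsHNChain (fun i => (p : ℤ_[p]) ^ k • F i) ⊥ ((p : ℤ_[p]) ^ k • B) := by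
    have hmap := hF.map ((X.satQuot D).smulHom k) (smul_right_injective _ (prime_pow_ne_zero k))
      (smul_right_injective _ (pow_ne_zero k prime_cast_ne_zero))
    rwa [Submodule.map_bot] at hmap
  have hiso (i : Fin r) := exists_isIso_subquot_comap_satQuotHom hk (hpF.le_succ i)
    (smul_mono_right _ le_top)
  have hG := hpF.of_isIso (F' := fun i => ((p : ℤ_[p]) ^ k • F i).comap (X.satQuotHom D).f)
    ((Submodule.comap_strictMono_of_surjective (X.satQuotHom_f_surjective D)).comp
      hpF.strictMono) hiso
  have hzero : ((p : ℤ_[p]) ^ k • F 0).comap (X.satQuotHom D).f = D := by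
    ext t
    rw [hpF.zero, Submodule.mem_comap, Submodule.mem_bot, X.satQuotHom_f_eq_zero]
  rw [hzero] at hG
  refine ⟨_, ?_, r + 1, _, hG.cons hbot hss fun i => ?_⟩
  · obtain ⟨j, hj⟩ := hB.pow_smul k
    refine ⟨j, ?_⟩
    rw [hF.last, ← Submodule.map_le_iff_le_comap, Submodule.map_pointwise_smul]
    exact (smul_mono_right _ le_top).trans hj
  · obtain ⟨φ, hφ⟩ := hiso i
    obtain ⟨E, hE, hle⟩ := hpF.exists_slope_le i
    exact hφ.slope_eq.trans_lt (hle.trans_lt (hslope E hE))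

end FullHNChain

section Descent

/-- The number of slopes in `X.relSlopes` which do not exceed the maximal slope of `X[p]`. -/
def slopeRank (X : Triple.{u, v, w} p C) : ℕ :=
  {s ∈ X.relSlopes | ∃ μ, X.IsMaxSlope μ ∧ s ≤ μ}.ncard

variable [hX : Fact X.IsIntegral]

theorem slopeRank_sub_lt {A : Submodule ℤ_[p] X.T} (hA : IsFull (p : ℤ_[p]) A) {μ : ℝ}
    (hμ : X.IsMaxSlope μ) (hlt : ∀ ν, (X.sub A).IsMaxSlope ν → ν < μ) :
    (X.sub A).slopeRank < X.slopeRank := by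
  refine Set.ncard_lt_ncard ⟨?_, fun hsub => ?_⟩ (X.finite_relSlopes.subset (Set.sep_subset _ _))
  · rintro s ⟨hs, ν, hν, hsν⟩
    exact ⟨relSlopes_sub_subset hA hs, μ, hμ, hsν.trans (hlt ν hν).le⟩
  · obtain ⟨-, ν, hν, hμν⟩ := hsub ⟨hμ.mem_relSlopes, μ, hμ, le_rfl⟩
    exact (hlt ν hν).not_ge hμν

theorem rkT_satQuot_lt {D : Submodule ℤ_[p] X.T} (hD : D ≠ ⊥) : (X.satQuot D).rkT < X.rkT := by
  have hsum : (X.satQuot D).rkT + Module.finrank ℤ_[p] D = X.rkT :=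
    D.finrank_quotient_add_finrank
  have : Nontrivial D := Submodule.nontrivial_iff_ne_bot.2 hD
  have hpos : 0 < Module.finrank ℤ_[p] D := Module.finrank_pos
  omega

omit hX in
theorem isFull_map_satQuotHom (D : Submodule ℤ_[p] X.T) {A : Submodule ℤ_[p] X.T}
    (hA : IsFull (p : ℤ_[p]) A) : IsFull (p : ℤ_[p]) (A.map (X.satQuotHom D).f) := by
  obtain ⟨m, hm⟩ := hA
  refine ⟨m, ?_⟩
  have hmono := Submodule.map_mono (f := (X.satQuotHom D).f) hm
  rwa [Submodule.map_pointwise_smul, Submodule.map_top,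
    LinearMap.range_eq_top.2 (X.satQuotHom_f_surjective _)] at hmono

theorem IsFirstSteps.hasFullHNChain_of_satQuot {μ : ℝ} {Y : ℕ → Submodule ℤ_[p] X.T}
    (h : IsFirstSteps μ Y) (hD : ⨅ k, Y k ≠ ⊥)
    (hchain : (X.satQuot (⨅ k, Y k)).HasFullHNChain) : X.HasFullHNChain :=
  hchain.of_satQuot h.isSaturated hD (h.semistable_sub_iInf hD) fun _ hE =>
    (h.slope_satQuot_sub_lt hE).trans_eq (h.slope_sub_iInf hD).symm

variable (X) in
theorem exists_isDescentStep_lt [Nontrivial X.T] : ∃ Z : Triple.{u, v, w} p C,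
    X.IsDescentStep Z ∧ (Z.HasFullHNChain → X.HasFullHNChain) ∧
      toLex (Z.rkT, Z.slopeRank) < toLex (X.rkT, X.slopeRank) := by
  obtain ⟨μ, hμ⟩ := exists_isMaxSlope (X := X)
  obtain ⟨Y, hY⟩ := hμ.exists_isFirstSteps
  obtain ⟨m, hm⟩ := hY.exists_le_iInf_sup
  have hfull : IsFull (p : ℤ_[p]) (Y m) := ⟨m, hY.pow_smul_top_le m⟩
  by_cases hD : ⨅ k, Y k = ⊥
  · exact ⟨X.sub (Y m), hY.isDescentStep_sub hm hD, .of_sub hfull, Prod.Lex.toLex_lt_toLex.2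
      (.inr ⟨rkT_sub hfull, slopeRank_sub_lt hfull hμ fun _ => hY.maxSlope_sub_lt hm hD⟩)⟩
  · have := Fact.mk (X.satQuot_isIntegral hY.isSaturated)
    have hfull' := isFull_map_satQuotHom (⨅ k, Y k) hfull
    exact ⟨_, hY.isDescentStep_satQuot hm,
      fun h => hY.hasFullHNChain_of_satQuot hD (.of_sub hfull' h),
      Prod.Lex.toLex_lt_toLex.2 (.inl ((rkT_sub hfull').trans_lt (rkT_satQuot_lt hD)))⟩

omit hX in
theorem hasFullHNChain_and_descentTerminates (X : Triple.{u, v, w} p C) (hX : X.IsIntegral) :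
    X.HasFullHNChain ∧ X.DescentTerminates := by
  induction hn : toLex (X.rkT, X.slopeRank) using WellFoundedLT.induction generalizing X with
  | ind n ih =>
    obtain hT | hT := subsingleton_or_nontrivial X.T
    · exact ⟨hasFullHNChain_of_subsingleton, descentTerminates_of_subsingleton hT⟩
    · have := Fact.mk hX
      obtain ⟨Z, hstep, hchain, hlt⟩ := X.exists_isDescentStep_lt
      obtain ⟨hZ, hterm⟩ := ih _ (hn ▸ hlt) Z hstep.1 rfl
      exact ⟨hchain hZ, hterm.of_isDescentStep hT hstep⟩

end Descent

end Triple

end HodgeTate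

end

theorem mainTheorem5_general (p : ℕ) [Fact p.Prime] (C : Type*) [NormedField C]
    [IsUltrametricDist C] [NormedAlgebra ℚ_[p] C] (X : HodgeTate.Triple p C)
    (hX : X.IsIntegral) :
    (∃ Y : HodgeTate.Triple p C, Y.IsIntegral ∧ X.Isogenous Y ∧ Y.IsHNType) ∧
      X.DescentTerminates := by
  have := Fact.mk hX
  have ⟨hchain, hterm⟩ := X.hasFullHNChain_and_descentTerminates hX
  exact ⟨hchain.exists_isogenous, hterm⟩

theorem mainTheorem5 (p : ℕ) [Fact p.Prime] (C : Type*) [NormedField C] [IsUltrametricDist C]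
    [NormedAlgebra ℚ_[p] C] [CompleteSpace C] [IsAlgClosed C]
    (X : HodgeTate.Triple p C) (hX : X.IsIntegral) :
    (∃ Y : HodgeTate.Triple p C, Y.IsIntegral ∧ X.Isogenous Y ∧ Y.IsHNType) ∧
      X.DescentTerminates :=
  mainTheorem5_general p C X hX
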